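/- For an entire function $f\colon\mathbb{C}\to\mathbb{C}$, let $\operatorname{sing}(f^{-1})$ be the set of its critical values together with its finite asymptotic values, where $s\in\mathbb{C}$ is an asymptotic value if there is a path $\gamma\colon[0,\infty)\to\mathbb{C}$ with $|\gamma(t)|\to\infty$ and $f(\gamma(t))\to s$ as $t\to\infty$. The local degree of $f$ at $z$ is the order of vanishing of $f-f(z)$ at $z$. For a nonempty set $A\subset\{2,4,6,\dots,\infty\}$, say that an entire function $f$ *realizes* $A$ if - $\operatorname{sing}(f^{-1})=\{0,1\}$; - the only singularities of $f^{-1}$ over $1$ are simple critical points, i.e. every critical point $z$ with $f(z)=1$ has local degree $2$, and $1$ is not an asymptotic value of $f$; - $A$ is precisely the set of local degrees of $f$ over $0$: a finite $d$ belongs to $A$ if and only if $f$ has local degree $d$ at some preimage of $0$, and $\infty\in A$ if and only if $0$ is an asymptotic value of $f$. Then: 1. For every nonempty $A\subset\{2,4,6,\dots,\infty\}$ there is a transcendental entire function realizing $A$. 2. If $A\neq B$ are nonempty subsets of $\{2,4,6,\dots,\infty\}$, $f$ is an entire function realizing $A$, and $g$ is an entire function realizing $B$, then $f$ and $g$ are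 not topologically equivalent: there are no homeomorphisms $\varphi,\psi\colon\mathbb{C}\to\mathbb{C}$ with $g=\psi\circ f\circ\varphi$. 3. Consequently, there is an uncountable set of pairwise topologically inequivalent transcendental entire functions, each having critical values exactly $0$ and $1$ and no finite asymptotic values, and each realizing some nonempty $A\subset\{2,4,6,\dots,\infty\}$. -/

import Mathlib

open Filter Topology

/-- An entire function is transcendental if it is not a polynomial. -/
def TranscendentalEntire (f : ℂ → ℂ) : Prop :=
  Differentiable ℂ f ∧ ¬ ∃ p : Polynomial ℂ, ∀ z, f z = p.eval z

/-- The critical values of `f`: the images of its critical points. -/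
def criticalValues (f : ℂ → ℂ) : Set ℂ :=
  {s | ∃ z, deriv f z = 0 ∧ f z = s}

/-- The finite asymptotic values of `f`: the limits of `f` along paths
`γ : [0, ∞) → ℂ` tending to infinity. -/
def asymptoticValues (f : ℂ → ℂ) : Set ℂ :=
  {s | ∃ γ : ℝ → ℂ, ContinuousOn γ (Set.Ici 0) ∧
    Tendsto (fun t => ‖γ t‖) atTop atTop ∧ Tendsto (fun t => f (γ t)) atTop (𝓝 s)}

/-- The set `sing(f⁻¹)` of singularities of the inverse function: critical values and
finite asymptotic values. -/
def singInv (f : ℂ → ℂ) : Set ℂ :=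
  criticalValues f ∪ asymptoticValues f

/-- The local degree of a holomorphic function `f` at `z`: the order of vanishing of
`f - f z` at `z`. -/
noncomputable def localDegree (f : ℂ → ℂ) (z : ℂ) : ℕ∞ :=
  analyticOrderAt (fun w => f w - f z) z

/-- The set `{2, 4, 6, …, ∞}`. -/
def evenOrInfinite : Set ℕ∞ :=
  {d | d = ⊤ ∨ ∃ k : ℕ, 1 ≤ k ∧ d = ((2 * k : ℕ) : ℕ∞)}

/-- The set of local degrees of `f` over `s`: the local degrees at the preimages of `s`, together
with `∞` if `s` is an asymptotic value. -/
def degreesOver (f : ℂ → ℂ) (s : ℂ) : Set ℕ∞ :=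
  {d | (∃ z, f z = s ∧ localDegree f z = d) ∨ (d = ⊤ ∧ s ∈ asymptoticValues f)}

/-- `f` is an entire function with `sing(f⁻¹) = {0, 1}`, its only singularities over `1` are simple
critical points (so there is no asymptotic value over `1`), and `A` is exactly the set of local
degrees over `0`. -/
structure Realizes (A : Set ℕ∞) (f : ℂ → ℂ) : Prop where
  entire : Differentiable ℂ f
  sing_eq : singInv f = {0, 1}
  simple_over_one : ∀ z, f z = 1 → deriv f z = 0 → localDegree f z = 2
  not_asymptotic_one : (1 : ℂ) ∉ asymptoticValues f
  degrees_eq : degreesOver f 0 = A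

/-- `f` and `g` are obtained from one another by pre- and post-composition with homeomorphisms of
the plane. -/
def TopologicallyEquivalent (f g : ℂ → ℂ) : Prop :=
  ∃ φ ψ : ℂ ≃ₜ ℂ, ∀ z, g z = ψ (f (φ z))

/-! ### The polynomials `x ((x - b) / (1 - b)) ^ (2k + 2)` -/

/-! Existence. For finite degrees the functions are infinite compositions of the polynomials
`chainPoly k`. Such a polynomial fixes 0, where it is locally injective, and 1, which is repelling
with multiplier at least 5; its critical points are a zero of multiplicity `2k + 2` and a simple one
with value 1. As 0 and 1 are fixed, all critical values of compositions lie in {0, 1}. Rescaling by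
the multipliers at 1, as for a Poincaré linearizer, makes the compositions converge to an entire
`chainFun k`, and `chainTail k n` is what remains after splitting off `n` outer factors. Along the
orbit of tails at a point, a critical point is met at most once, since afterwards the orbit sits at
0 or 1; hence the degrees over 0 are exactly the `2 (k i + 1)`, and those over 1 are 1 or 2
(`localDegree_chainTail_cases`).

No asymptotic values (`asymptoticValues_chainFun`). Along an asymptotic path every tail converges.
If some limit is neither 0 nor 1, the inverse branches of the compositions on a disc there are
bounded with derivatives tending to 0 uniformly, by Harnack, so the tails stay close to 1 on the
whole path; but a path to infinity takes late tails away from 1. If all limits are 0, or all are 1,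
barrier circles around the fixed point confine all tails, again a contradiction.

Infinite degree. The function `exp (z ^ 2)` handles {∞}. For mixed sets, `chainFun` is precomposed
with `β + exp z` for a zero `β`: this creates the asymptotic value 0 and loses only the point `β`,
whose degree is repeated elsewhere.

Inequivalence. The local degree counts nearby preimages, so it is topological, and asymptotic values
are transported. No element of `A` is 1, so 0 must go to a singular value: to 0, giving `A = B`, or
to 1, giving `A = {2}`. Symmetry finishes. Subsets of ℕ then index the uncountable family. -/

theorem exists_chainZero (k : ℕ) : ∃ b : ℝ, 1 / 2 < b ∧ b < 1 ∧
    b ^ (2 * k + 3) * (2 * k + 2 : ℝ) ^ (2 * k + 2) =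
      (2 * k + 3 : ℝ) ^ (2 * k + 3) * (1 - b) ^ (2 * k + 2) := by
  set h : ℝ → ℝ := fun b => b ^ (2 * k + 3) * (2 * k + 2 : ℝ) ^ (2 * k + 2) -
    (2 * k + 3 : ℝ) ^ (2 * k + 3) * (1 - b) ^ (2 * k + 2) with hh
  have hc : ContinuousOn h (Set.Icc (1 / 2) 1) := by fun_prop
  have h0 : h (1 / 2) < 0 := by
    -- At `b = 1/2` also `1 - b = 1/2`, so a common power of `1/2` factors out.
    have e : h (1 / 2) = (1 / 2) ^ (2 * k + 2) *
        ((1 / 2) * (2 * k + 2 : ℝ) ^ (2 * k + 2) - (2 * k + 3 : ℝ) ^ (2 * k + 3)) := by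
      simp only [hh]; norm_num; ring
    rw [e]
    refine mul_neg_of_pos_of_neg (by positivity) ?_
    have h1 : (2 * k + 2 : ℝ) ^ (2 * k + 2) ≤ (2 * k + 3 : ℝ) ^ (2 * k + 2) := by gcongr; norm_num
    have h2 : (2 * k + 3 : ℝ) ^ (2 * k + 2) ≤ (2 * k + 3 : ℝ) ^ (2 * k + 3) :=
      pow_le_pow_right₀ (by linarith [(Nat.cast_nonneg k : (0 : ℝ) ≤ k)]) (by omega)
    have h3 : 0 < (2 * k + 2 : ℝ) ^ (2 * k + 2) := by positivity
    linarith
  have h1 : 0 < h 1 := by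
    simp only [hh]; simp; positivity
  obtain ⟨b, hb, hb0⟩ := intermediate_value_Ioo (by norm_num) hc ⟨h0, h1⟩
  exact ⟨b, hb.1, hb.2, by simpa [hh, sub_eq_zero] using hb0⟩

/-- The zero `b` of multiplicity `2k + 2` of the polynomial `chainPoly k`. -/
noncomputable def chainZero (k : ℕ) : ℝ := Classical.choose (exists_chainZero k)

theorem half_lt_chainZero (k : ℕ) : 1 / 2 < chainZero k :=
  (Classical.choose_spec (exists_chainZero k)).1

theorem chainZero_lt_one (k : ℕ) : chainZero k < 1 :=
  (Classical.choose_spec (exists_chainZero k)).2.1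

/-- This is the condition that the critical value at `b / (2k + 3)` be 1, cleared of denominators.
-/
theorem chainZero_eq (k : ℕ) :
    chainZero k ^ (2 * k + 3) * (2 * k + 2 : ℝ) ^ (2 * k + 2) =
      (2 * k + 3 : ℝ) ^ (2 * k + 3) * (1 - chainZero k) ^ (2 * k + 2) :=
  (Classical.choose_spec (exists_chainZero k)).2.2

/-- The simple critical point of `chainPoly k`. -/
noncomputable def chainCrit (k : ℕ) : ℝ := chainZero k / (2 * k + 3)

/-- The derivative of `chainPoly k` at its fixed point `1`. -/
noncomputable def chainMult (k : ℕ) : ℝ := 1 + (2 * k + 2) / (1 - chainZero k)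

open Polynomial in
/-- The polynomial `x ((x - b) / (1 - b)) ^ (2k + 2)`. -/
noncomputable def chainPoly (k : ℕ) : Polynomial ℂ :=
  X * (C ((1 - chainZero k : ℂ)⁻¹) * (X - C (chainZero k : ℂ))) ^ (2 * k + 2)

theorem one_sub_chainZero_ne (k : ℕ) : (1 - chainZero k : ℂ) ≠ 0 := by
  have := chainZero_lt_one k
  exact_mod_cast (sub_pos.2 this).ne'

theorem chainPoly_eval (k : ℕ) (z : ℂ) :
    (chainPoly k).eval z = z * ((1 - chainZero k : ℂ)⁻¹ * (z - chainZero k)) ^ (2 * k + 2) := by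
  simp [chainPoly]

theorem chainPoly_eval_zero (k : ℕ) : (chainPoly k).eval 0 = 0 := by simp [chainPoly_eval]

theorem chainPoly_eval_one (k : ℕ) : (chainPoly k).eval 1 = 1 := by
  simp [chainPoly_eval, inv_mul_cancel₀ (one_sub_chainZero_ne k)]

theorem chainPoly_eval_chainZero (k : ℕ) : (chainPoly k).eval (chainZero k : ℂ) = 0 := by
  simp [chainPoly_eval]

theorem chainPoly_eval_eq_zero_iff {k : ℕ} {z : ℂ} :
    (chainPoly k).eval z = 0 ↔ z = 0 ∨ z = chainZero k := by
  rw [chainPoly_eval, mul_eq_zero, pow_eq_zero_iff (by omega), mul_eq_zero, inv_eq_zero,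
    sub_eq_zero (a := z)]
  exact or_congr_right (or_iff_right (one_sub_chainZero_ne k))

theorem chainCrit_pos (k : ℕ) : 0 < chainCrit k :=
  div_pos (by linarith [half_lt_chainZero k]) (by positivity)

theorem chainCrit_lt (k : ℕ) : chainCrit k < 1 / 3 := by
  rw [chainCrit, div_lt_iff₀ (by positivity)]
  have := chainZero_lt_one k
  have : (0 : ℝ) ≤ k := k.cast_nonneg
  linarith

theorem chainCrit_lt_chainZero (k : ℕ) : chainCrit k < chainZero k := by
  linarith [chainCrit_lt k, half_lt_chainZero k]

theorem chainCrit_mul_pow (k : ℕ) :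
    chainCrit k * ((1 - chainZero k)⁻¹ * (chainZero k - chainCrit k)) ^ (2 * k + 2) = 1 := by
  have h1 : (1 - chainZero k) ≠ 0 := (sub_pos.2 (chainZero_lt_one k)).ne'
  have h2 : (2 * k + 3 : ℝ) ≠ 0 := by positivity
  have e : chainZero k - chainCrit k = chainZero k * (2 * k + 2) / (2 * k + 3) := by
    rw [chainCrit]; field_simp; ring
  rw [e, chainCrit]
  have := chainZero_eq k
  rw [show 2 * k + 3 = 2 * k + 2 + 1 from rfl, pow_succ, pow_succ (2 * k + 3 : ℝ)] at this
  have h3 := pow_ne_zero (2 * k + 2) h1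
  have h4 := pow_ne_zero (2 * k + 2) h2
  rw [mul_pow, div_pow, mul_pow, inv_pow]
  generalize (1 - chainZero k) ^ (2 * k + 2) = A at *
  generalize (2 * k + 3 : ℝ) ^ (2 * k + 2) = B at *
  generalize (2 * k + 2 : ℝ) ^ (2 * k + 2) = D at *
  generalize chainZero k ^ (2 * k + 2) = E at *
  field_simp
  linarith

theorem chainPoly_eval_chainCrit (k : ℕ) : (chainPoly k).eval (chainCrit k : ℂ) = 1 := by
  rw [chainPoly_eval]
  have := chainCrit_mul_pow k
  have e : ((1 - chainZero k : ℂ)⁻¹ * (chainCrit k - chainZero k)) ^ (2 * k + 2) =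
      ((1 - chainZero k : ℂ)⁻¹ * (chainZero k - chainCrit k)) ^ (2 * k + 2) := by
    rw [← neg_sub (chainZero k : ℂ) (chainCrit k), mul_neg, Even.neg_pow ⟨k + 1, by ring⟩]
  rw [e]
  exact_mod_cast this

/-- This is where `b > 1/2` enters: `(2k + 2) / (1 - b) ≥ 4`. -/
theorem five_le_chainMult (k : ℕ) : 5 ≤ chainMult k := by
  have h := half_lt_chainZero k
  have h1 := sub_pos.2 (chainZero_lt_one k)
  have : 4 ≤ (2 * k + 2 : ℝ) / (1 - chainZero k) := by
    rw [le_div_iff₀ h1]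
    have : (0 : ℝ) ≤ k := k.cast_nonneg
    nlinarith
  rw [chainMult]; linarith

theorem chainMult_pos (k : ℕ) : 0 < chainMult k := by linarith [five_le_chainMult k]

theorem chainMult_ne_zero (k : ℕ) : (chainMult k : ℂ) ≠ 0 := by
  exact_mod_cast (chainMult_pos k).ne'

theorem chainPoly_derivative_eval (k : ℕ) (z : ℂ) :
    (chainPoly k).derivative.eval z = ((1 - chainZero k : ℂ)⁻¹ * (z - chainZero k)) ^ (2 * k + 1) *
      ((1 - chainZero k : ℂ)⁻¹ * ((2 * k + 3) * z - chainZero k)) := by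
  simp [chainPoly, Polynomial.derivative_pow]
  ring

theorem chainPoly_hasDerivAt (k : ℕ) (z : ℂ) :
    HasDerivAt (fun z => (chainPoly k).eval z) ((chainPoly k).derivative.eval z) z :=
  (chainPoly k).hasDerivAt z

theorem chainCrit_cast (k : ℕ) : (2 * k + 3 : ℂ) * chainCrit k = chainZero k := by
  have : (2 * k + 3 : ℝ) * chainCrit k = chainZero k := by
    rw [chainCrit]; field_simp
  exact_mod_cast this

theorem two_mul_add_three_ne (k : ℕ) : (2 * k + 3 : ℂ) ≠ 0 := by
  exact_mod_cast (by positivity : (2 * k + 3 : ℝ) ≠ 0)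

theorem chainPoly_derivative_eval_eq_zero_iff {k : ℕ} {z : ℂ} :
    (chainPoly k).derivative.eval z = 0 ↔ z = chainCrit k ∨ z = chainZero k := by
  rw [chainPoly_derivative_eval, show (2 * k + 3) * z - chainZero k =
    (2 * k + 3) * (z - chainCrit k) by rw [mul_sub, chainCrit_cast]]
  have h := inv_ne_zero (one_sub_chainZero_ne k)
  rw [mul_eq_zero, pow_eq_zero_iff (by omega), mul_eq_zero_iff_left h, mul_eq_zero_iff_left h,
    mul_eq_zero_iff_left (two_mul_add_three_ne k), sub_eq_zero, sub_eq_zero]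
  exact or_comm

theorem chainPoly_critical {k : ℕ} {z : ℂ} (h : (chainPoly k).derivative.eval z = 0) :
    (chainPoly k).eval z = 0 ∨ (chainPoly k).eval z = 1 := by
  rcases chainPoly_derivative_eval_eq_zero_iff.1 h with rfl | rfl
  · exact .inr (chainPoly_eval_chainCrit k)
  · exact .inl (chainPoly_eval_chainZero k)

/-- Outside the unit disc `|z - b| ≥ 1 - b`, so the power has modulus at least 1. This later bounds
all inverse branches at once. -/
theorem norm_le_norm_chainPoly {k : ℕ} {z : ℂ} (hz : 1 ≤ ‖z‖) : ‖z‖ ≤ ‖(chainPoly k).eval z‖ := by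
  rw [chainPoly_eval, norm_mul, norm_pow, norm_mul, norm_inv]
  have h1 := sub_pos.2 (chainZero_lt_one k)
  have e : ‖(1 - chainZero k : ℂ)‖ = 1 - chainZero k := by
    rw [← Complex.ofReal_one, ← Complex.ofReal_sub, Complex.norm_real, Real.norm_of_nonneg h1.le]
  have h2 : 1 - chainZero k ≤ ‖z - chainZero k‖ := by
    have := norm_sub_norm_le z (chainZero k)
    rw [Complex.norm_real, Real.norm_of_nonneg (by linarith [half_lt_chainZero k])] at this
    linarith
  have h3 : 1 ≤ ‖(1 - chainZero k : ℂ)‖⁻¹ * ‖z - chainZero k‖ := by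
    rw [e, inv_mul_eq_div, le_div_iff₀ h1]; linarith
  exact le_mul_of_one_le_right (norm_nonneg _) (one_le_pow₀ h3)

/-- On this circle `|z - b|` is smallest at the critical point itself, where the value is 1. The
circle is the barrier around the fixed point 0. -/
theorem one_le_norm_chainPoly {k : ℕ} {z : ℂ} (hz : ‖z‖ = chainCrit k) :
    1 ≤ ‖(chainPoly k).eval z‖ := by
  rw [chainPoly_eval, norm_mul, norm_pow, norm_mul, norm_inv, hz]
  have h1 := sub_pos.2 (chainZero_lt_one k)
  have e : ‖(1 - chainZero k : ℂ)‖ = 1 - chainZero k := by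
    rw [← Complex.ofReal_one, ← Complex.ofReal_sub, Complex.norm_real, Real.norm_of_nonneg h1.le]
  have h2 : chainZero k - chainCrit k ≤ ‖z - chainZero k‖ := by
    have := norm_sub_norm_le (chainZero k : ℂ) z
    rw [Complex.norm_real, Real.norm_of_nonneg (by linarith [half_lt_chainZero k]),
      norm_sub_rev, hz] at this
    linarith
  rw [e]
  refine (chainCrit_mul_pow k).symm.le.trans ?_
  have := (chainCrit_pos k).le
  have := (sub_pos.2 (chainCrit_lt_chainZero k)).le
  gcongr

/-- The derivative of `chainPoly k` near `1` is `chainMult k` times a product of factors `1 + O(v)`. -/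
theorem norm_derivative_chainPoly_sub_le (k : ℕ) (v : ℂ) :
    ‖(chainPoly k).derivative.eval (1 + v) - chainMult k‖ ≤
      chainMult k * (Real.exp (chainMult k * ‖v‖) - 1) := by
  have h1 := sub_pos.2 (chainZero_lt_one k)
  have hb := half_lt_chainZero k
  have hk : (0 : ℝ) ≤ k := k.cast_nonneg
  have h1c := one_sub_chainZero_ne k
  have hdr : (0 : ℝ) < 2 * k + 3 - chainZero k := by linarith
  have hdc : (2 * k + 3 - chainZero k : ℂ) ≠ 0 := by exact_mod_cast hdr.ne'
  -- The first `2k + 1` factors come from the multiple zero `b`, the last from the simple critical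
  -- point. The coefficients of `v` add up to at most `(2k + 2) / (1 - b)`, which is below the
  -- multiplier.
  set F : ℕ → ℂ := fun i => if i < 2 * k + 1 then (1 - chainZero k : ℂ)⁻¹ * v else
    ((2 * k + 3) / (2 * k + 3 - chainZero k)) * v with hF
  have e1 : (chainPoly k).derivative.eval (1 + v) =
      chainMult k * ∏ i ∈ Finset.range (2 * k + 2), (1 + F i) := by
    rw [Finset.prod_range_succ, Finset.prod_congr rfl (g := fun _ => 1 + (1 - chainZero k : ℂ)⁻¹ * v)
      (fun i hi => by simp only [hF, Finset.mem_range.1 hi, if_true])]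
    rw [chainPoly_derivative_eval, Finset.prod_const, Finset.card_range]
    simp only [hF, lt_irrefl, if_false, chainMult]
    have : (1 - chainZero k : ℂ)⁻¹ * (1 + v - chainZero k) = 1 + (1 - chainZero k : ℂ)⁻¹ * v := by
      field_simp; ring
    rw [this]
    push_cast
    field_simp
    ring
  have e2 : ∑ i ∈ Finset.range (2 * k + 2), ‖F i‖ ≤ chainMult k * ‖v‖ := by
    rw [Finset.sum_range_succ, Finset.sum_congr rfl (g := fun _ => (1 - chainZero k)⁻¹ * ‖v‖)
      (fun i hi => ?_)]
    · simp only [hF, lt_irrefl, if_false, Finset.sum_const, Finset.card_range, nsmul_eq_mul]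
      have : ‖((2 * k + 3 : ℂ) / (2 * k + 3 - chainZero k))‖ =
          (2 * k + 3) / (2 * k + 3 - chainZero k) := by
        have : ((2 * k + 3 : ℂ) / (2 * k + 3 - chainZero k)) =
          (((2 * k + 3) / (2 * k + 3 - chainZero k) : ℝ) : ℂ) := by push_cast; rfl
        rw [this, Complex.norm_real, Real.norm_of_nonneg (by positivity)]
      rw [norm_mul, this, ← mul_assoc, ← add_mul]
      gcongr
      rw [chainMult]
      have : (2 * k + 3) / (2 * k + 3 - chainZero k) ≤ (1 - chainZero k)⁻¹ := by
        rw [div_le_iff₀ hdr, inv_mul_eq_div, le_div_iff₀ h1]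
        nlinarith
      push_cast
      have e : (2 * k + 2 : ℝ) / (1 - chainZero k) = (2 * k + 1) * (1 - chainZero k)⁻¹ +
        (1 - chainZero k)⁻¹ := by field_simp; ring
      linarith
    · simp only [hF, Finset.mem_range.1 hi, if_true, norm_mul, norm_inv]
      congr 2
      rw [← Complex.ofReal_one, ← Complex.ofReal_sub, Complex.norm_real, Real.norm_of_nonneg h1.le]
  rw [e1, ← mul_sub_one, norm_mul, Complex.norm_real, Real.norm_of_nonneg (chainMult_pos k).le]
  have := (chainMult_pos k).le
  gcongr
  exact (Finset.norm_prod_one_add_sub_one_le _ _).trans (by gcongr)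

/-- In the coordinate `u = chainMult k * v` at `1`, `chainPoly k` is close to the identity. -/
theorem norm_chainPoly_sub_sub_le (k : ℕ) {M : ℝ} (hM : M ≤ 1) {v w : ℂ}
    (hv : chainMult k * ‖v‖ ≤ M) (hw : chainMult k * ‖w‖ ≤ M) :
    ‖(chainPoly k).eval (1 + v) - (chainPoly k).eval (1 + w) - chainMult k * (v - w)‖ ≤
      2 * M * chainMult k * ‖v - w‖ := by
  have hl := chainMult_pos k
  have key := Convex.norm_image_sub_le_of_norm_hasDerivWithin_le
    (f := fun v : ℂ => (chainPoly k).eval (1 + v) - chainMult k * v)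
    (f' := fun v => (chainPoly k).derivative.eval (1 + v) - chainMult k)
    (s := Metric.closedBall 0 (M / chainMult k)) (x := w) (y := v) (C := 2 * M * chainMult k)
    (fun x _ => by
      have h1 := (chainPoly_hasDerivAt k (1 + x)).comp_const_add 1 x
      have h2 := (hasDerivAt_id x).const_mul (chainMult k : ℂ)
      rw [mul_one] at h2
      exact (h1.sub h2).hasDerivWithinAt)
    (fun x hx => by
      rw [mem_closedBall_zero_iff, le_div_iff₀ hl, mul_comm] at hx
      refine (norm_derivative_chainPoly_sub_le k x).trans ?_
      have h0 : 0 ≤ chainMult k * ‖x‖ := by positivity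
      have := Real.abs_exp_sub_one_le (x := chainMult k * ‖x‖) (by rw [abs_of_nonneg h0]; linarith)
      rw [abs_of_nonneg (by linarith [Real.add_one_le_exp (chainMult k * ‖x‖)]),
        abs_of_nonneg h0] at this
      nlinarith)
    (convex_closedBall _ _)
    (by rw [mem_closedBall_zero_iff, le_div_iff₀ hl, mul_comm]; exact hw)
    (by rw [mem_closedBall_zero_iff, le_div_iff₀ hl, mul_comm]; exact hv)
  refine le_of_eq_of_le (congrArg _ ?_) key
  ring

/-- `chainPoly k` on the real line. -/
theorem chainPoly_eval_ofReal (k : ℕ) (x : ℝ) : (chainPoly k).eval (x : ℂ) =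
    ((x * ((1 - chainZero k)⁻¹ * (x - chainZero k)) ^ (2 * k + 2) : ℝ) : ℂ) := by
  rw [chainPoly_eval]; push_cast; rfl

/-- Since `1 - b < 1/2`, the affine factor already at least doubles the distance to 1; the power and
the factor `x` only decrease the value. -/
theorem chainPoly_expanding (k : ℕ) {x : ℝ} (hx : chainZero k ≤ x) (hx1 : x ≤ 1) :
    x * ((1 - chainZero k)⁻¹ * (x - chainZero k)) ^ (2 * k + 2) ≤ 1 - 2 * (1 - x) := by
  have h1 := sub_pos.2 (chainZero_lt_one k)
  have hb := half_lt_chainZero k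
  set t := (1 - chainZero k)⁻¹ * (x - chainZero k) with ht
  have ht0 : 0 ≤ t := mul_nonneg (inv_nonneg.2 h1.le) (sub_nonneg.2 hx)
  have ht1 : t ≤ 1 := by rw [ht, inv_mul_eq_div, div_le_one h1]; linarith
  have h3 : t ^ (2 * k + 2) ≤ t := by
    simpa using pow_le_pow_of_le_one ht0 ht1 (by omega : 1 ≤ 2 * k + 2)
  have h4 : t ≤ 1 - 2 * (1 - x) := by
    rw [ht, inv_mul_eq_div, div_le_iff₀ h1]; nlinarith
  have h5 : x * t ^ (2 * k + 2) ≤ 1 * t ^ (2 * k + 2) := by gcongr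
  linarith

/-! ### Local degrees -/

theorem localDegree_comp {f g : ℂ → ℂ} {z : ℂ} (hf : AnalyticAt ℂ f (g z))
    (hg : AnalyticAt ℂ g z) :
    localDegree (fun w => f (g w)) z = localDegree f (g z) * localDegree g z := by
  have hf' : AnalyticAt ℂ (fun w => f w - f (g z)) (g z) := hf.sub analyticAt_const
  exact hf'.analyticOrderAt_comp hg

theorem localDegree_eq_one {f : ℂ → ℂ} {z : ℂ} (hf : AnalyticAt ℂ f z) (h : deriv f z ≠ 0) :
    localDegree f z = 1 :=
  hf.analyticOrderAt_sub_eq_one_of_deriv_ne_zero h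

theorem deriv_ne_zero_of_localDegree {f : ℂ → ℂ} {z : ℂ} (hf : AnalyticAt ℂ f z)
    (h : localDegree f z = 1) : deriv f z ≠ 0 := by
  intro h0
  have h1 := hf.analyticOrderAt_deriv_add_one
  have h2 := hf.deriv.analyticOrderAt_ne_zero.2 h0
  rw [← localDegree, h] at h1
  exact h2 (by simpa using h1)

theorem analyticAt_chainPoly (k : ℕ) (z : ℂ) : AnalyticAt ℂ (fun z => (chainPoly k).eval z) z :=
  (chainPoly k).differentiable.analyticAt z

theorem deriv_chainPoly (k : ℕ) :
    deriv (fun z => (chainPoly k).eval z) = fun z => (chainPoly k).derivative.eval z :=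
  funext fun _ => Polynomial.deriv _

theorem localDegree_chainPoly_chainZero (k : ℕ) :
    localDegree (fun z => (chainPoly k).eval z) (chainZero k) = ((2 * (k + 1) : ℕ) : ℕ∞) := by
  have hc : (chainZero k : ℂ) ≠ 0 := by
    exact_mod_cast (by linarith [half_lt_chainZero k] : chainZero k ≠ 0)
  have ha : AnalyticAt ℂ (fun w => (chainPoly k).eval w -
      (chainPoly k).eval (chainZero k : ℂ)) (chainZero k) :=
    (analyticAt_chainPoly k _).sub analyticAt_const
  rw [localDegree, ha.analyticOrderAt_eq_natCast]
  refine ⟨fun z => z * ((1 - chainZero k : ℂ)⁻¹) ^ (2 * k + 2), by fun_prop,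
    mul_ne_zero hc (pow_ne_zero _ (inv_ne_zero (one_sub_chainZero_ne k))), .of_forall fun z => ?_⟩
  simp only [chainPoly_eval, smul_eq_mul, mul_pow]
  ring

theorem localDegree_chainPoly_chainCrit (k : ℕ) :
    localDegree (fun z => (chainPoly k).eval z) (chainCrit k) = 2 := by
  have h : analyticOrderAt (deriv fun z => (chainPoly k).eval z) (chainCrit k : ℂ) = (1 : ℕ) := by
    have ha := (analyticAt_chainPoly k (chainCrit k)).deriv
    rw [AnalyticAt.analyticOrderAt_eq_natCast ha, deriv_chainPoly]
    refine ⟨fun z => ((1 - chainZero k : ℂ)⁻¹ * (z - chainZero k)) ^ (2 * k + 1) *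
      ((1 - chainZero k : ℂ)⁻¹ * (2 * k + 3)), by fun_prop, ?_, .of_forall fun z => ?_⟩
    · have h1 : (chainCrit k - chainZero k : ℂ) ≠ 0 := by
        exact_mod_cast (sub_neg.2 (chainCrit_lt_chainZero k)).ne
      have h2 := inv_ne_zero (one_sub_chainZero_ne k)
      exact mul_ne_zero (pow_ne_zero _ (mul_ne_zero h2 h1)) (mul_ne_zero h2 (two_mul_add_three_ne k))
    · simp only [chainPoly_derivative_eval, ← chainCrit_cast, smul_eq_mul]
      ring
  rw [localDegree, ← (analyticAt_chainPoly k _).analyticOrderAt_deriv_add_one, h]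
  norm_num

/-! ### Convergence of the normalized compositions -/

/-- For a sequence `k`, the composition of the first `m` of the polynomials `chainPoly (k i)`,
normalized to have derivative `1` at the point `0`, which is mapped to the fixed point `1`. -/
noncomputable def chainApprox : ℕ → (ℕ → ℕ) → ℂ → ℂ
  | 0, _, z => 1 + z
  | m + 1, k, z => (chainPoly (k 0)).eval (chainApprox m (fun i => k (i + 1)) (z / chainMult (k 0)))

theorem norm_div_chainMult (k : ℕ) (z : ℂ) : ‖z / chainMult k‖ = ‖z‖ / chainMult k := by
  rw [norm_div, Complex.norm_real, Real.norm_of_nonneg (chainMult_pos k).le]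

theorem norm_div_chainMult_le (k : ℕ) (z : ℂ) : ‖z / chainMult k‖ ≤ ‖z‖ / 5 := by
  rw [norm_div_chainMult]
  exact div_le_div_of_nonneg_left (norm_nonneg _) (by norm_num) (five_le_chainMult k)

theorem chainMult_mul_norm_le {k : ℕ} {z y : ℂ} (hz : ‖z‖ ≤ 1 / 12)
    (h : ‖y - 1 - z / chainMult k‖ ≤ 3 * ‖z / chainMult k‖ ^ 2) :
    chainMult k * ‖y - 1‖ ≤ 21 / 20 * ‖z‖ := by
  have hl := chainMult_pos k
  have h1 : ‖y - 1‖ ≤ ‖z‖ / chainMult k + 3 * (‖z‖ / chainMult k) * (‖z‖ / 5) := by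
    have := norm_le_norm_sub_add (y - 1) (z / chainMult k)
    have h3 := norm_div_chainMult_le k z
    have h4 := norm_nonneg (z / chainMult k)
    rw [norm_div_chainMult] at *
    nlinarith
  calc chainMult k * ‖y - 1‖
      ≤ chainMult k * (‖z‖ / chainMult k + 3 * (‖z‖ / chainMult k) * (‖z‖ / 5)) := by gcongr
    _ = ‖z‖ + 3 / 5 * ‖z‖ * ‖z‖ := by field_simp
    _ ≤ 21 / 20 * ‖z‖ := by nlinarith [norm_nonneg z]

/-- The constant 3 reproduces itself: the nonlinearity of the polynomial costs `2 (21/20)²`, and the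
inherited error shrinks to `3/5` because the multiplier is at least 5; the sum is below 3. -/
theorem norm_chainPoly_sub_one_sub_le {k : ℕ} {z y : ℂ} (hz : ‖z‖ ≤ 1 / 12)
    (h : ‖y - 1 - z / chainMult k‖ ≤ 3 * ‖z / chainMult k‖ ^ 2) :
    ‖(chainPoly k).eval y - 1 - z‖ ≤ 3 * ‖z‖ ^ 2 := by
  have hl := chainMult_pos k
  have h1 := chainMult_mul_norm_le hz h
  have h2 := norm_chainPoly_sub_sub_le k (M := 21 / 20 * ‖z‖) (by linarith) h1 (w := 0)
    (by simp)
  simp only [add_sub_cancel, add_zero, chainPoly_eval_one, sub_zero] at h2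
  have e : (chainPoly k).eval y - 1 - z =
      ((chainPoly k).eval y - 1 - chainMult k * (y - 1)) +
        chainMult k * (y - 1 - z / chainMult k) := by
    have := chainMult_ne_zero k
    field_simp; ring
  have h3 : ‖(chainMult k : ℂ) * (y - 1 - z / chainMult k)‖ ≤ 3 / 5 * ‖z‖ ^ 2 := by
    rw [norm_mul, Complex.norm_real, Real.norm_of_nonneg hl.le]
    have h5 := norm_div_chainMult_le k z
    have h4 := norm_nonneg z
    calc chainMult k * ‖y - 1 - z / chainMult k‖
        ≤ chainMult k * (3 * ‖z / chainMult k‖ ^ 2) := by gcongr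
      _ = 3 * ‖z‖ * ‖z / chainMult k‖ := by rw [norm_div_chainMult]; field_simp
      _ ≤ 3 * ‖z‖ * (‖z‖ / 5) := by gcongr
      _ = 3 / 5 * ‖z‖ ^ 2 := by ring
  rw [e]
  refine (norm_add_le _ _).trans ?_
  nlinarith [norm_nonneg z]

theorem norm_chainApprox_sub_le (m : ℕ) : ∀ (k : ℕ → ℕ) {z : ℂ}, ‖z‖ ≤ 1 / 12 →
    ‖chainApprox m k z - 1 - z‖ ≤ 3 * ‖z‖ ^ 2 := by
  induction m with
  | zero => intro k z _; simp [chainApprox]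
  | succ m ih =>
    intro k z hz
    exact norm_chainPoly_sub_one_sub_le hz
      (ih _ ((norm_div_chainMult_le _ z).trans (by linarith [norm_nonneg z])))

/-- With `λ` the multiplier, the polynomial stretches differences by at most `5λ/4` near 1, while
the quadratic factor gains `1/λ²`; the net ratio is at most `1/4`. -/
theorem norm_chainApprox_succ_sub_le (m : ℕ) : ∀ (k : ℕ → ℕ) {z : ℂ}, ‖z‖ ≤ 1 / 12 →
    ‖chainApprox (m + 1) k z - chainApprox m k z‖ ≤ 3 * (1 / 4) ^ m * ‖z‖ ^ 2 := by
  induction m with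
  | zero =>
    intro k z hz
    have := norm_chainApprox_sub_le 1 k hz
    rw [sub_sub] at this
    simpa [chainApprox] using this
  | succ m ih =>
    intro k z hz
    have hl := chainMult_pos (k 0)
    have hz' : ‖z / chainMult (k 0)‖ ≤ 1 / 12 :=
      (norm_div_chainMult_le _ z).trans (by linarith [norm_nonneg z])
    have h1 := chainMult_mul_norm_le hz (norm_chainApprox_sub_le m (fun i => k (i + 1)) hz')
    have h2 := chainMult_mul_norm_le hz (norm_chainApprox_sub_le (m + 1) (fun i => k (i + 1)) hz')
    have h3 := ih (fun i => k (i + 1)) hz'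
    rw [chainApprox, chainApprox]
    set y := chainApprox m (fun i => k (i + 1)) (z / chainMult (k 0))
    set y' := chainApprox (m + 1) (fun i => k (i + 1)) (z / chainMult (k 0))
    have h4 := norm_chainPoly_sub_sub_le (k 0) (M := 21 / 20 * ‖z‖) (by linarith) h2 h1
    simp only [add_sub_cancel, sub_sub_sub_cancel_right] at h4
    have h5 : ‖(chainPoly (k 0)).eval y' - (chainPoly (k 0)).eval y‖ ≤
        (5 / 4) * chainMult (k 0) * ‖y' - y‖ := by
      have := norm_le_norm_sub_add ((chainPoly (k 0)).eval y' - (chainPoly (k 0)).eval y)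
        (chainMult (k 0) * (y' - y))
      rw [norm_mul (chainMult (k 0) : ℂ), Complex.norm_real, Real.norm_of_nonneg hl.le] at this
      have h6 : 0 ≤ chainMult (k 0) * ‖y' - y‖ := by positivity
      nlinarith
    calc _ ≤ (5 / 4) * chainMult (k 0) * ‖y' - y‖ := h5
      _ ≤ (5 / 4) * chainMult (k 0) * (3 * (1 / 4) ^ m * ‖z / chainMult (k 0)‖ ^ 2) := by gcongr
      _ = (15 / 4) * (1 / 4) ^ m * ‖z‖ * ‖z / chainMult (k 0)‖ := by
          rw [norm_div_chainMult]; field_simp; ring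
      _ ≤ (15 / 4) * (1 / 4) ^ m * ‖z‖ * (‖z‖ / 5) := by
          gcongr; exact norm_div_chainMult_le _ _
      _ = 3 * (1 / 4) ^ (m + 1) * ‖z‖ ^ 2 := by ring

theorem dist_chainApprox_le (k : ℕ → ℕ) {z : ℂ} (hz : ‖z‖ ≤ 1 / 12) (m : ℕ) :
    dist (chainApprox m k z) (chainApprox (m + 1) k z) ≤ 1 * (1 / 4) ^ m := by
  rw [dist_comm, dist_eq_norm]
  refine (norm_chainApprox_succ_sub_le m k hz).trans ?_
  have : ‖z‖ ^ 2 ≤ (1 / 12) ^ 2 := by gcongr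
  have h4 : (0 : ℝ) < (1 / 4) ^ m := by positivity
  nlinarith

/-- The entire function that is the limit of the normalized compositions `chainApprox m k`. -/
noncomputable def chainFun (k : ℕ → ℕ) (z : ℂ) : ℂ := limUnder atTop fun m => chainApprox m k z

/-- The recursion divides the argument by a multiplier at least 5, so convergence spreads from the
disc of radius `1/12` to the whole plane. The sequence must vary, as the recursion shifts it. -/
theorem exists_tendsto_chainApprox (j : ℕ) : ∀ (k : ℕ → ℕ) {z : ℂ}, ‖z‖ ≤ 5 ^ j / 12 →
    ∃ w, Tendsto (fun m => chainApprox m k z) atTop (𝓝 w) := by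
  induction j with
  | zero =>
    intro k z hz
    exact cauchySeq_tendsto_of_complete
      (cauchySeq_of_le_geometric (1 / 4) 1 (by norm_num) (dist_chainApprox_le k (by simpa using hz)))
  | succ j ih =>
    intro k z hz
    obtain ⟨w, hw⟩ := ih (fun i => k (i + 1)) (z := z / chainMult (k 0))
      ((norm_div_chainMult_le _ z).trans (by rw [pow_succ] at hz; linarith))
    exact ⟨_, (tendsto_add_atTop_iff_nat 1).1
      (((chainPoly (k 0)).continuous.tendsto w).comp hw)⟩

theorem exists_le_five_pow (x : ℝ) : ∃ j : ℕ, x < 5 ^ j / 12 := by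
  obtain ⟨j, hj⟩ := pow_unbounded_of_one_lt (12 * x) (by norm_num : (1 : ℝ) < 5)
  exact ⟨j, by linarith⟩

theorem tendsto_chainApprox (k : ℕ → ℕ) (z : ℂ) :
    Tendsto (fun m => chainApprox m k z) atTop (𝓝 (chainFun k z)) := by
  obtain ⟨j, hj⟩ := exists_le_five_pow ‖z‖
  exact tendsto_nhds_limUnder (exists_tendsto_chainApprox j k hj.le)

theorem chainFun_eq (k : ℕ → ℕ) (z : ℂ) :
    chainFun k z = (chainPoly (k 0)).eval (chainFun (fun i => k (i + 1)) (z / chainMult (k 0))) :=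
  tendsto_nhds_unique ((tendsto_add_atTop_iff_nat 1).2 (tendsto_chainApprox k z))
    (((chainPoly (k 0)).continuous.tendsto _).comp (tendsto_chainApprox _ _))

theorem norm_chainFun_sub_le (k : ℕ → ℕ) {z : ℂ} (hz : ‖z‖ ≤ 1 / 12) :
    ‖chainFun k z - 1 - z‖ ≤ 3 * ‖z‖ ^ 2 :=
  le_of_tendsto (((tendsto_chainApprox k z).sub_const 1).sub_const z).norm
    (.of_forall fun m => norm_chainApprox_sub_le m k hz)

theorem chainFun_zero (k : ℕ → ℕ) : chainFun k 0 = 1 := by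
  have := norm_chainFun_sub_le k (z := 0) (by norm_num)
  simpa [sub_eq_zero] using this

theorem differentiable_chainApprox (m : ℕ) : ∀ k, Differentiable ℂ (chainApprox m k) := by
  induction m with
  | zero => intro k; exact (differentiable_const _).add differentiable_id
  | succ m ih =>
    intro k
    exact (chainPoly (k 0)).differentiable.comp ((ih _).comp (differentiable_id.div_const _))

theorem differentiableOn_chainFun (j : ℕ) : ∀ k : ℕ → ℕ,
    DifferentiableOn ℂ (chainFun k) (Metric.ball 0 (5 ^ j / 12)) := by
  induction j with
  | zero =>
    intro k
    refine TendstoLocallyUniformlyOn.differentiableOn (φ := atTop)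
      (F := fun m => chainApprox m k) (TendstoUniformlyOn.tendstoLocallyUniformlyOn ?_)
      (.of_forall fun m => (differentiable_chainApprox m k).differentiableOn) Metric.isOpen_ball
    rw [Metric.tendstoUniformlyOn_iff]
    intro ε hε
    have h0 : Tendsto (fun m : ℕ => (1 : ℝ) * (1 / 4) ^ m / (1 - 1 / 4)) atTop (𝓝 0) := by
      simpa using ((tendsto_pow_atTop_nhds_zero_of_lt_one (r := (1 / 4 : ℝ)) (by norm_num)
        (by norm_num)).const_mul 1).div_const (1 - 1 / 4)
    filter_upwards [h0.eventually (gt_mem_nhds hε)] with m hm z hz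
    rw [dist_comm]
    refine (dist_le_of_le_geometric_of_tendsto (1 / 4) 1 (by norm_num)
      (dist_chainApprox_le k ?_) (tendsto_chainApprox k z) m).trans_lt hm
    simpa using (mem_ball_zero_iff.1 hz).le
  | succ j ih =>
    intro k
    have h1 : DifferentiableOn ℂ
        (fun z => (chainPoly (k 0)).eval (chainFun (fun i => k (i + 1)) (z / chainMult (k 0))))
        (Metric.ball 0 (5 ^ (j + 1) / 12)) := by
      refine (chainPoly (k 0)).differentiable.comp_differentiableOn
        ((ih _).comp (differentiable_id.div_const _).differentiableOn fun z hz => ?_)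
      rw [mem_ball_zero_iff] at hz ⊢
      exact (norm_div_chainMult_le _ z).trans_lt (by rw [pow_succ] at hz; linarith)
    exact h1.congr fun z _ => chainFun_eq k z

theorem differentiable_chainFun (k : ℕ → ℕ) : Differentiable ℂ (chainFun k) := by
  intro z
  obtain ⟨j, hj⟩ := exists_le_five_pow ‖z‖
  exact (differentiableOn_chainFun j k).differentiableAt
    (Metric.isOpen_ball.mem_nhds (mem_ball_zero_iff.2 hj))

theorem norm_deriv_chainFun_sub_one_le (k : ℕ → ℕ) {z : ℂ} (hz : ‖z‖ ≤ 1 / 24) :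
    ‖deriv (chainFun k) z - 1‖ ≤ 1 / 2 := by
  have hd : Differentiable ℂ (fun w => chainFun k w - 1 - w) :=
    ((differentiable_chainFun k).sub_const 1).sub differentiable_id
  -- Cauchy's estimate: the circle stays in the disc of radius `1/12`, where the error is at most
  -- `3/144 = 1/48`.
  have h := Complex.norm_deriv_le_of_forall_mem_sphere_norm_le (c := z) (R := 1 / 24)
    (C := 1 / 48) (by norm_num) hd.diffContOnCl (fun w hw => by
      have hw' : ‖w‖ ≤ 1 / 12 := by
        have h1 := norm_le_norm_sub_add w z
        rw [mem_sphere_iff_norm] at hw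
        linarith
      refine (norm_chainFun_sub_le k hw').trans ?_
      have : ‖w‖ ^ 2 ≤ (1 / 12) ^ 2 := by gcongr
      linarith)
  have e : deriv (fun w => chainFun k w - 1 - w) z = deriv (chainFun k) z - 1 := by
    have := (((differentiable_chainFun k z).hasDerivAt.sub_const 1).sub (hasDerivAt_id z)).deriv
    exact this
  rw [e] at h
  linarith

theorem sixteenth_le_norm_chainFun_sub_one (k : ℕ → ℕ) {z : ℂ} (hz : ‖z‖ = 1 / 12) :
    1 / 16 ≤ ‖chainFun k z - 1‖ := by
  have h := norm_chainFun_sub_le k hz.le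
  have h1 := norm_sub_norm_le z (z - (chainFun k z - 1))
  rw [sub_sub_cancel, norm_sub_rev z] at h1
  rw [hz] at h h1
  linarith

/-! ### Tails of the infinite composition -/

/-- The product of the first `n` multipliers. -/
noncomputable def chainScale (k : ℕ → ℕ) (n : ℕ) : ℝ := ∏ i ∈ Finset.range n, chainMult (k i)

/-- The functions `g` with `chainFun k = p ∘ g` for `p` the composition of the first `n`
polynomials. -/
noncomputable def chainTail (k : ℕ → ℕ) (n : ℕ) (z : ℂ) : ℂ :=
  chainFun (fun i => k (i + n)) (z / chainScale k n)

theorem chainTail_zero (k : ℕ → ℕ) : chainTail k 0 = chainFun k := by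
  ext z; simp [chainTail, chainScale]

theorem chainTail_eq (k : ℕ → ℕ) (n : ℕ) (z : ℂ) :
    chainTail k n z = (chainPoly (k n)).eval (chainTail k (n + 1) z) := by
  have h : chainScale k (n + 1) = chainScale k n * chainMult (k n) := Finset.prod_range_succ ..
  rw [chainTail, chainFun_eq, chainTail, h]
  simp only [zero_add, Complex.ofReal_mul, div_div, add_right_comm _ 1 n, add_assoc]

theorem five_pow_le_chainScale (k : ℕ → ℕ) (n : ℕ) : 5 ^ n ≤ chainScale k n := by
  induction n with
  | zero => simp [chainScale]
  | succ n ih =>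
    rw [chainScale, Finset.prod_range_succ, pow_succ]
    exact mul_le_mul ih (five_le_chainMult _) (by norm_num) (le_trans (by positivity) ih)

theorem chainScale_pos (k : ℕ → ℕ) (n : ℕ) : 0 < chainScale k n :=
  lt_of_lt_of_le (by positivity) (five_pow_le_chainScale k n)

theorem norm_div_chainScale (k : ℕ → ℕ) (n : ℕ) (z : ℂ) :
    ‖z / chainScale k n‖ = ‖z‖ / chainScale k n := by
  rw [norm_div, Complex.norm_real, Real.norm_of_nonneg (chainScale_pos k n).le]

theorem tendsto_chainScale (k : ℕ → ℕ) : Tendsto (chainScale k) atTop atTop :=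
  tendsto_atTop_mono (five_pow_le_chainScale k) (tendsto_pow_atTop_atTop_of_one_lt (by norm_num))

theorem tendsto_norm_div_chainScale (k : ℕ → ℕ) (z : ℂ) :
    Tendsto (fun n => ‖z / chainScale k n‖) atTop (𝓝 0) := by
  simp only [norm_div_chainScale]
  exact (tendsto_chainScale k).const_div_atTop _

theorem differentiable_chainTail (k : ℕ → ℕ) (n : ℕ) : Differentiable ℂ (chainTail k n) :=
  (differentiable_chainFun _).comp (differentiable_id.div_const _)

theorem deriv_chainTail (k : ℕ → ℕ) (n : ℕ) (z : ℂ) : deriv (chainTail k n) z =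
    deriv (chainFun fun i => k (i + n)) (z / chainScale k n) / chainScale k n := by
  have h1 := (differentiable_chainFun (fun i => k (i + n)) (z / chainScale k n)).hasDerivAt.comp z
    ((hasDerivAt_id z).div_const (chainScale k n : ℂ))
  rw [← div_eq_mul_one_div] at h1
  exact h1.deriv

theorem tendsto_chainTail (k : ℕ → ℕ) (z : ℂ) :
    Tendsto (fun n => chainTail k n z) atTop (𝓝 1) := by
  rw [tendsto_iff_norm_sub_tendsto_zero]
  have h0 := tendsto_norm_div_chainScale k z
  refine squeeze_zero' (.of_forall fun _ => norm_nonneg _) ?_ (by simpa only [mul_zero] using h0.const_mul 2)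
  filter_upwards [h0.eventually (gt_mem_nhds (by norm_num : (0 : ℝ) < 1 / 12))] with n hn
  have h1 := norm_chainFun_sub_le (fun i => k (i + n)) hn.le
  have h2 := norm_le_norm_sub_add (chainTail k n z - 1) (z / chainScale k n)
  rw [chainTail] at *
  nlinarith [norm_nonneg (z / chainScale k n)]

theorem eventually_deriv_chainTail_ne_zero (k : ℕ → ℕ) (z : ℂ) :
    ∀ᶠ n in atTop, deriv (chainTail k n) z ≠ 0 := by
  filter_upwards [(tendsto_norm_div_chainScale k z).eventually
    (gt_mem_nhds (by norm_num : (0 : ℝ) < 1 / 24))] with n hn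
  rw [deriv_chainTail]
  refine div_ne_zero (fun h => ?_) (by exact_mod_cast (chainScale_pos k n).ne')
  have := norm_deriv_chainFun_sub_one_le (fun i => k (i + n)) hn.le
  rw [h] at this
  norm_num at this

theorem tendsto_deriv_chainTail (k : ℕ → ℕ) (z : ℂ) :
    Tendsto (fun n => deriv (chainTail k n) z) atTop (𝓝 0) := by
  rw [tendsto_zero_iff_norm_tendsto_zero]
  refine squeeze_zero' (.of_forall fun _ => norm_nonneg _) ?_
    ((tendsto_chainScale k).const_div_atTop (3 / 2 : ℝ))
  filter_upwards [(tendsto_norm_div_chainScale k z).eventually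
    (gt_mem_nhds (by norm_num : (0 : ℝ) < 1 / 24))] with n hn
  rw [deriv_chainTail, norm_div_chainScale]
  have := norm_deriv_chainFun_sub_one_le (fun i => k (i + n)) hn.le
  have h2 := norm_le_norm_sub_add (deriv (chainFun fun i => k (i + n)) (z / chainScale k n)) 1
  rw [norm_one] at h2
  have := (chainScale_pos k n).le
  gcongr
  linarith

/-! ### Local degrees of `chainFun` -/

theorem localDegree_chainTail (k : ℕ → ℕ) (n : ℕ) (z : ℂ) : localDegree (chainTail k n) z =
    localDegree (fun w => (chainPoly (k n)).eval w) (chainTail k (n + 1) z) *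
      localDegree (chainTail k (n + 1)) z := by
  rw [← localDegree_comp (analyticAt_chainPoly _ _) ((differentiable_chainTail k _).analyticAt z)]
  congr 1
  exact funext (chainTail_eq k n)

theorem localDegree_chainPoly_eq_one {k : ℕ} {z : ℂ} (h : z ≠ chainCrit k) (h' : z ≠ chainZero k) :
    localDegree (fun w => (chainPoly k).eval w) z = 1 := by
  refine localDegree_eq_one (analyticAt_chainPoly k z) ?_
  rw [deriv_chainPoly]
  exact fun h0 => (chainPoly_derivative_eval_eq_zero_iff.1 h0).elim h h'

theorem localDegree_chainPoly_zero (k : ℕ) :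
    localDegree (fun w => (chainPoly k).eval w) 0 = 1 :=
  localDegree_chainPoly_eq_one (by exact_mod_cast (chainCrit_pos k).ne)
    (by exact_mod_cast ((chainCrit_pos k).trans (chainCrit_lt_chainZero k)).ne)

theorem localDegree_chainPoly_one (k : ℕ) :
    localDegree (fun w => (chainPoly k).eval w) 1 = 1 :=
  localDegree_chainPoly_eq_one
    (by exact_mod_cast ((chainCrit_lt_chainZero k).trans (chainZero_lt_one k)).ne')
    (by exact_mod_cast (chainZero_lt_one k).ne')

/-- Backward induction from a late tail, which is locally injective and nonzero at `z`. The degree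
stays 1 until the orbit hits a critical point; it then lands on the fixed point 0 or 1, where later
factors have degree 1 and the degree is frozen. -/
theorem localDegree_chainTail_cases (k : ℕ → ℕ) (n : ℕ) (z : ℂ) :
    (chainTail k n z ≠ 0 ∧ localDegree (chainTail k n) z = 1) ∨
    (chainTail k n z = 1 ∧ localDegree (chainTail k n) z = 2) ∨
    (chainTail k n z = 0 ∧ ∃ i, localDegree (chainTail k n) z = ((2 * (k i + 1) : ℕ) : ℕ∞)) := by
  obtain ⟨N, hnN, h0, h1⟩ := ((eventually_ge_atTop n).and
    ((eventually_deriv_chainTail_ne_zero k z).and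
      ((tendsto_chainTail k z).eventually_ne one_ne_zero))).exists
  obtain ⟨j, rfl⟩ := Nat.exists_eq_add_of_le hnN
  clear hnN
  induction j generalizing n with
  | zero =>
    exact .inl ⟨h1, localDegree_eq_one ((differentiable_chainTail k _).analyticAt z) h0⟩
  | succ j ih =>
    rw [show n + (j + 1) = n + 1 + j by ring] at h0 h1
    rw [localDegree_chainTail, chainTail_eq]
    rcases ih (n + 1) h0 h1 with ⟨h, hd⟩ | ⟨h, hd⟩ | ⟨h, i, hd⟩
    · rw [hd, mul_one]
      by_cases hb : chainTail k (n + 1) z = chainZero (k n)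
      · rw [hb]
        exact .inr (.inr ⟨chainPoly_eval_chainZero _, n, localDegree_chainPoly_chainZero _⟩)
      · refine (eq_or_ne (chainTail k (n + 1) z) (chainCrit (k n))).elim (fun ha => ?_) fun ha => ?_
        · rw [ha]
          exact .inr (.inl ⟨chainPoly_eval_chainCrit _, localDegree_chainPoly_chainCrit _⟩)
        · exact .inl ⟨fun h0 => (chainPoly_eval_eq_zero_iff.1 h0).elim h hb,
            localDegree_chainPoly_eq_one ha hb⟩
    · rw [h, hd, localDegree_chainPoly_one, one_mul]
      exact .inr (.inl ⟨chainPoly_eval_one _, rfl⟩)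
    · rw [h, localDegree_chainPoly_zero, one_mul]
      exact .inr (.inr ⟨chainPoly_eval_zero _, i, hd⟩)

theorem localDegree_chainTail_eq_one {k : ℕ → ℕ} {n : ℕ} {z : ℂ} (h0 : chainTail k n z ≠ 0)
    (h1 : chainTail k n z ≠ 1) : localDegree (chainTail k n) z = 1 := by
  rcases localDegree_chainTail_cases k n z with ⟨-, h⟩ | ⟨h, -⟩ | ⟨h, -⟩
  exacts [h, absurd h h1, absurd h h0]

theorem deriv_chainTail_ne_zero {k : ℕ → ℕ} {n : ℕ} {z : ℂ} (h0 : chainTail k n z ≠ 0)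
    (h1 : chainTail k n z ≠ 1) : deriv (chainTail k n) z ≠ 0 :=
  deriv_ne_zero_of_localDegree ((differentiable_chainTail k n).analyticAt z)
    (localDegree_chainTail_eq_one h0 h1)

theorem chainTail_eq_zero_of_le {k : ℕ → ℕ} {m n : ℕ} (h : m ≤ n) {z : ℂ}
    (hz : chainTail k n z = 0) : chainTail k m z = 0 := by
  induction n, h using Nat.le_induction with
  | base => exact hz
  | succ n _ ih => exact ih (by rw [chainTail_eq, hz, chainPoly_eval_zero])

theorem localDegree_chainTail_of_le {k : ℕ → ℕ} {m n : ℕ} (h : m ≤ n) {z : ℂ}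
    (hz : chainTail k n z = 0) :
    localDegree (chainTail k m) z = localDegree (chainTail k n) z := by
  induction n, h using Nat.le_induction with
  | base => rfl
  | succ n _ ih =>
    rw [ih (by rw [chainTail_eq, hz, chainPoly_eval_zero]), localDegree_chainTail, hz,
      localDegree_chainPoly_zero, one_mul]

/-! ### `chainFun` on the real line -/

theorem chainApprox_ofReal_im (m : ℕ) : ∀ (k : ℕ → ℕ) (x : ℝ), (chainApprox m k x).im = 0 := by
  induction m with
  | zero => intro k x; simp [chainApprox]
  | succ m ih =>
    intro k x
    have h := ih (fun i => k (i + 1)) (x / chainMult (k 0))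
    rw [chainApprox, ← Complex.ofReal_div, ← Complex.re_add_im (chainApprox m _ _), h]
    simp only [Complex.ofReal_zero, zero_mul, add_zero]
    rw [chainPoly_eval_ofReal, Complex.ofReal_im]

theorem chainFun_ofReal (k : ℕ → ℕ) (x : ℝ) : ((chainFun k x).re : ℂ) = chainFun k x := by
  have h : (chainFun k x).im = 0 :=
    tendsto_nhds_unique ((Complex.continuous_im.tendsto _).comp (tendsto_chainApprox k x))
      (by simp [Function.comp_def, chainApprox_ofReal_im])
  apply Complex.ext <;> simp [h]

theorem exists_chainFun_re_eq {k : ℕ → ℕ} {x y : ℝ} (h : (chainFun k x).re ≤ y) (hy : y ≤ 1) :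
    ∃ t : ℝ, chainFun k t = y := by
  have hc : Continuous fun t : ℝ => (chainFun k t).re :=
    Complex.continuous_re.comp ((differentiable_chainFun k).continuous.comp Complex.continuous_ofReal)
  obtain ⟨t, ht⟩ := mem_range_of_exists_le_of_exists_ge hc ⟨x, h⟩
    ⟨0, by simpa [chainFun_zero] using hy⟩
  exact ⟨t, (chainFun_ofReal k t).symm.trans (congrArg _ ht)⟩

/-- Each functional equation doubles the distance below 1 that is reached on the real line, until 0
is reached. -/
theorem exists_chainFun_re_le (j : ℕ) : ∀ k : ℕ → ℕ, ∃ x : ℝ,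
    (chainFun k x).re ≤ max 0 (1 - 2 ^ j / 16) := by
  induction j with
  | zero =>
    intro k
    refine ⟨-(1 / 12), le_max_of_le_right ?_⟩
    have h := norm_chainFun_sub_le k (z := ((-(1 / 12) : ℝ) : ℂ))
      (by rw [Complex.norm_real]; norm_num)
    rw [← chainFun_ofReal, ← Complex.ofReal_one, ← Complex.ofReal_sub, ← Complex.ofReal_sub,
      Complex.norm_real, Complex.norm_real, Real.norm_eq_abs, Real.norm_eq_abs] at h
    have := (abs_le.1 h).2
    norm_num [abs_of_pos] at this ⊢
    linarith
  | succ j ih =>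
    intro k
    obtain ⟨x, hx⟩ := ih fun i => k (i + 1)
    have hb := half_lt_chainZero (k 0)
    have hb1 := chainZero_lt_one (k 0)
    have hj : (0 : ℝ) < 2 ^ j / 16 := by positivity
    -- Truncating at `b` keeps the value in `[b, 1]`, where the polynomial expands; the value `b`
    -- itself is sent to 0.
    obtain ⟨t, ht⟩ := exists_chainFun_re_eq
      (y := max (chainZero (k 0)) (1 - 2 ^ j / 16))
      (hx.trans (max_le_max_right _ (by linarith))) (max_le hb1.le (by linarith))
    refine ⟨chainMult (k 0) * t, ?_⟩
    rw [chainFun_eq, Complex.ofReal_mul, mul_div_cancel_left₀ _ (chainMult_ne_zero _), ht]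
    rcases max_cases (chainZero (k 0)) (1 - 2 ^ j / 16) with ⟨h, -⟩ | ⟨h, h'⟩
    · rw [h, chainPoly_eval_chainZero]; simp
    · rw [h, chainPoly_eval_ofReal, Complex.ofReal_re]
      refine (chainPoly_expanding _ h'.le (by linarith)).trans (le_max_of_le_right ?_)
      rw [pow_succ]; linarith

theorem exists_chainTail_eq (k : ℕ → ℕ) (n : ℕ) {y : ℝ} (h0 : 0 ≤ y) (h1 : y ≤ 1) :
    ∃ z : ℂ, chainTail k n z = y := by
  -- For `j = 4` the bound `1 - 2 ^ j / 16` is 0.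
  obtain ⟨x, hx⟩ := exists_chainFun_re_le 4 fun i => k (i + n)
  obtain ⟨t, ht⟩ := exists_chainFun_re_eq (hx.trans (by norm_num; exact h0)) h1
  refine ⟨chainScale k n * t, ?_⟩
  rw [chainTail, mul_div_cancel_left₀ _ (by exact_mod_cast (chainScale_pos k n).ne'), ht]

theorem exists_zero_chainTail (k : ℕ → ℕ) (n : ℕ) :
    ∃ z : ℂ, chainTail k (n + 1) z = chainZero (k n) :=
  exists_chainTail_eq k _ (by linarith [half_lt_chainZero (k n)]) (chainZero_lt_one _).le

/-- A zero of `chainFun k` of local degree `2 (k n + 1)`. -/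
noncomputable def chainPt (k : ℕ → ℕ) (n : ℕ) : ℂ := Classical.choose (exists_zero_chainTail k n)

theorem chainTail_chainPt (k : ℕ → ℕ) (n : ℕ) : chainTail k (n + 1) (chainPt k n) = chainZero (k n) :=
  Classical.choose_spec (exists_zero_chainTail k n)

theorem chainZero_ne_zero (k : ℕ) : (chainZero k : ℂ) ≠ 0 := by
  exact_mod_cast (by linarith [half_lt_chainZero k] : chainZero k ≠ 0)

theorem chainZero_ne_one (k : ℕ) : (chainZero k : ℂ) ≠ 1 := by
  exact_mod_cast (chainZero_lt_one k).ne

theorem chainTail_chainPt_eq_zero (k : ℕ → ℕ) (n : ℕ) : chainTail k n (chainPt k n) = 0 := by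
  rw [chainTail_eq, chainTail_chainPt, chainPoly_eval_chainZero]

theorem chainFun_chainPt (k : ℕ → ℕ) (n : ℕ) : chainFun k (chainPt k n) = 0 := by
  rw [← chainTail_zero]
  exact chainTail_eq_zero_of_le n.zero_le (chainTail_chainPt_eq_zero k n)

theorem localDegree_chainFun_chainPt (k : ℕ → ℕ) (n : ℕ) :
    localDegree (chainFun k) (chainPt k n) = ((2 * (k n + 1) : ℕ) : ℕ∞) := by
  rw [← chainTail_zero, localDegree_chainTail_of_le n.zero_le (chainTail_chainPt_eq_zero k n),
    localDegree_chainTail, localDegree_chainTail_eq_one, chainTail_chainPt, mul_one,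
    localDegree_chainPoly_chainZero]
  · rw [chainTail_chainPt]; exact chainZero_ne_zero _
  · rw [chainTail_chainPt]; exact chainZero_ne_one _

/-- For `m < n` the tail of index `m + 1` already vanishes at the `n`-th point, but equals `b ≠ 0`
at the `m`-th. -/
theorem chainPt_injective (k : ℕ → ℕ) : Function.Injective (chainPt k) := by
  have h : ∀ m n, m < n → chainPt k m ≠ chainPt k n := fun m n hmn he => by
    have h1 := chainTail_eq_zero_of_le (Nat.succ_le_of_lt hmn) (chainTail_chainPt_eq_zero k n)
    rw [← he, Nat.succ_eq_add_one, chainTail_chainPt] at h1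
    exact chainZero_ne_zero _ h1
  intro m n he
  rcases lt_trichotomy m n with hl | hl | hl
  exacts [absurd he (h _ _ hl), hl, absurd he.symm (h _ _ hl)]

theorem exists_critical_one_chainFun (k : ℕ → ℕ) :
    ∃ z, chainFun k z = 1 ∧ localDegree (chainFun k) z = 2 := by
  have h0 := chainCrit_pos (k 0)
  have h1 := chainCrit_lt (k 0)
  obtain ⟨z, hz⟩ := exists_chainTail_eq k 1 h0.le (by linarith)
  refine ⟨z, ?_, ?_⟩
  · rw [← chainTail_zero, chainTail_eq, zero_add, hz, chainPoly_eval_chainCrit]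
  · rw [← chainTail_zero, localDegree_chainTail, zero_add, localDegree_chainTail_eq_one, hz,
      localDegree_chainPoly_chainCrit, mul_one] <;> rw [hz]
    · exact_mod_cast h0.ne'
    · exact_mod_cast (by linarith : chainCrit (k 0) ≠ 1)

theorem deriv_eq_zero_of_localDegree {f : ℂ → ℂ} {z : ℂ} (hf : AnalyticAt ℂ f z)
    (h : localDegree f z ≠ 1) : deriv f z = 0 := by
  by_contra h0
  exact h (localDegree_eq_one hf h0)

theorem natCast_two_mul_ne_one (n : ℕ) : ((2 * n : ℕ) : ℕ∞) ≠ 1 := by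
  rw [← Nat.cast_one, Ne, Nat.cast_inj]; omega

theorem criticalValues_chainFun (k : ℕ → ℕ) : criticalValues (chainFun k) = {0, 1} := by
  have ha := fun z => (differentiable_chainFun k).analyticAt z
  ext s
  constructor
  · rintro ⟨z, hz, rfl⟩
    by_contra h
    simp only [Set.mem_insert_iff, Set.mem_singleton_iff, not_or] at h
    exact deriv_chainTail_ne_zero (k := k) (n := 0) (by rw [chainTail_zero]; exact h.1)
      (by rw [chainTail_zero]; exact h.2) (by rw [chainTail_zero]; exact hz)
  · rintro (rfl | rfl)
    · exact ⟨chainPt k 0, deriv_eq_zero_of_localDegree (ha _)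
        (by rw [localDegree_chainFun_chainPt]; exact natCast_two_mul_ne_one _), chainFun_chainPt k 0⟩
    · obtain ⟨z, h1, h2⟩ := exists_critical_one_chainFun k
      exact ⟨z, deriv_eq_zero_of_localDegree (ha z) (by rw [h2]; norm_num), h1⟩

/-! ### Nonvanishing holomorphic functions on a disc -/

/-- The logarithm is a primitive of `h' / h`; then `h * exp (-φ)` has zero derivative. -/
theorem exists_eqOn_exp {h : ℂ → ℂ} {c : ℂ} {r : ℝ} (hr : 0 < r)
    (hd : DifferentiableOn ℂ h (Metric.ball c r)) (h0 : ∀ w ∈ Metric.ball c r, h w ≠ 0) :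
    ∃ φ : ℂ → ℂ, DifferentiableOn ℂ φ (Metric.ball c r) ∧
      ∀ w ∈ Metric.ball c r, h w = Complex.exp (φ w) := by
  have hc : c ∈ Metric.ball c r := Metric.mem_ball_self hr
  have hq : DifferentiableOn ℂ (fun w => deriv h w / h w) (Metric.ball c r) :=
    (hd.deriv Metric.isOpen_ball).div hd h0
  obtain ⟨φ, hφc, hφ⟩ := hq.isExactOn_ball.with_val_at c (Complex.log (h c))
  refine ⟨φ, fun w hw => (hφ w hw).differentiableAt.differentiableWithinAt, fun w hw => ?_⟩
  have key := Metric.isOpen_ball.is_const_of_deriv_eq_zero (convex_ball c r).isPreconnected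
    (f := fun w => h w * Complex.exp (-φ w))
    (hd.mul (DifferentiableOn.cexp fun w hw =>
      (hφ w hw).differentiableAt.differentiableWithinAt.neg))
    (fun w hw => by
      have h1 := (hd.differentiableAt (Metric.isOpen_ball.mem_nhds hw)).hasDerivAt
      have h2 := (h1.mul (hφ w hw).neg.cexp).deriv
      have h3 := h0 w hw
      refine h2.trans ?_
      simp only [Pi.neg_apply, Pi.zero_apply]
      field_simp
      ring) hw hc
  simp only [hφc, Complex.exp_neg, Complex.exp_log (h0 c hc), mul_inv_cancel₀ (h0 c hc)] at key
  exact (mul_inv_eq_one₀ (Complex.exp_ne_zero _)).1 key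

/-- A form of Harnack's inequality on the disc of half the radius. -/
theorem re_le_three_mul_re {u : ℂ → ℂ} {c w : ℂ} {r : ℝ}
    (hd : DifferentiableOn ℂ u (Metric.ball c r)) (h0 : ∀ w ∈ Metric.ball c r, 0 < (u w).re)
    (hw : w ∈ Metric.ball c (r / 2)) : (u c).re ≤ 3 * (u w).re := by
  have hr : 0 < r := by linarith [Metric.pos_of_mem_ball hw]
  have hwr : w ∈ Metric.ball c r := Metric.ball_subset_ball (by linarith) hw
  have hc : c ∈ Metric.ball c r := Metric.mem_ball_self hr
  set d : ℂ → ℂ := fun w => u w + (starRingEnd ℂ) (u c) with hdd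
  have hre : ∀ w ∈ Metric.ball c r, 0 < (d w).re := fun w hw => by
    simpa [hdd] using add_pos (h0 w hw) (h0 c hc)
  have hne : ∀ w ∈ Metric.ball c r, d w ≠ 0 := fun w hw h => by
    have := hre w hw; rw [h] at this; simp at this
  have key : ∀ a : ℂ, 0 < a.re → Complex.normSq (a - u c) < Complex.normSq
      (a + (starRingEnd ℂ) (u c)) := fun a ha => by
    have := mul_pos ha (h0 c hc)
    simp only [Complex.normSq_apply, Complex.sub_re, Complex.sub_im, Complex.add_re, Complex.add_im,
      Complex.conj_re, Complex.conj_im]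
    nlinarith
  -- The Cayley transform sends the right half-plane to the unit disc and `u c` to 0, so Schwarz's
  -- lemma applies and gives modulus at most `1/2` at half the radius.
  have hs := Complex.dist_le_div_mul_dist_of_mapsTo_ball (f := fun w => (u w - u c) / d w)
    (c := c) (R₁ := r) (R₂ := 1) (z := w) ((hd.sub_const _).div (hd.add_const _) hne)
    (fun z hz => by
      simp only [sub_self, zero_div]
      rw [mem_closedBall_zero_iff, norm_div, div_le_one (norm_pos_iff.2 (hne z hz))]
      refine (sq_le_sq₀ (norm_nonneg _) (norm_nonneg _)).1 ?_
      rw [← Complex.normSq_eq_norm_sq, ← Complex.normSq_eq_norm_sq]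
      exact (key _ (h0 z hz)).le) hwr
  have h1 : ‖u w - u c‖ ≤ 1 / 2 * ‖d w‖ := by
    have h2 : 1 / r * dist w c ≤ 1 / 2 := by
      rw [one_div_mul_eq_div, div_le_div_iff₀ hr (by norm_num)]
      linarith [Metric.mem_ball.1 hw]
    have h3 := hs.trans h2
    simp only [sub_self, zero_div, dist_zero_right, norm_div] at h3
    rwa [div_le_iff₀ (norm_pos_iff.2 (hne w hwr))] at h3
  have h4 := pow_le_pow_left₀ (norm_nonneg _) h1 2
  rw [mul_pow, ← Complex.normSq_eq_norm_sq, ← Complex.normSq_eq_norm_sq] at h4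
  simp only [hdd, Complex.normSq_apply, Complex.sub_re, Complex.sub_im, Complex.add_re,
    Complex.add_im, Complex.conj_re, Complex.conj_im] at h4
  have h5 := h0 c hc
  have h6 := h0 w hwr
  have h7 : ((u w).re - (u c).re) ^ 2 ≤ (1 / 2 * ((u w).re + (u c).re)) ^ 2 := by nlinarith [sq_nonneg ((u w).im + -(u c).im)]
  have := abs_le_of_sq_le_sq h7 (by linarith)
  linarith [(abs_le.1 this).1]

/-- Harnack for the positive harmonic function `log (M / |h|)`. Thus smallness at the centre spreads
to the smaller disc for bounded zero-free functions. -/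
theorem norm_pow_three_le {h : ℂ → ℂ} {c w : ℂ} {r M : ℝ}
    (hd : DifferentiableOn ℂ h (Metric.ball c r)) (h0 : ∀ w ∈ Metric.ball c r, h w ≠ 0)
    (hM : ∀ w ∈ Metric.ball c r, ‖h w‖ < M) (hw : w ∈ Metric.ball c (r / 2)) :
    ‖h w‖ ^ 3 ≤ M ^ 2 * ‖h c‖ := by
  have hr : 0 < r := by linarith [Metric.pos_of_mem_ball hw]
  have hwr : w ∈ Metric.ball c r := Metric.ball_subset_ball (by linarith) hw
  have hM0 : 0 < M := (norm_nonneg _).trans_lt (hM w hwr)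
  obtain ⟨φ, hφ, he⟩ := exists_eqOn_exp hr hd h0
  have e : ∀ w ∈ Metric.ball c r, ‖h w‖ = Real.exp (φ w).re := fun w hw => by
    rw [he w hw, Complex.norm_exp]
  have key := re_le_three_mul_re (u := fun w => Real.log M - φ w) (hφ.const_sub _)
    (fun w hw => by
      have h1 := hM w hw
      rw [e w hw] at h1
      simpa using (Real.lt_log_iff_exp_lt hM0).2 h1) hw
  simp only [Complex.sub_re, Complex.ofReal_re] at key
  rw [e w hwr, e c (Metric.mem_ball_self hr), ← Real.exp_nat_mul]
  calc Real.exp ((3 : ℕ) * (φ w).re) ≤ Real.exp ((2 : ℕ) * Real.log M + (φ c).re) := by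
        apply Real.exp_le_exp.2; push_cast; linarith
    _ = M ^ 2 * Real.exp (φ c).re := by rw [Real.exp_add, Real.exp_nat_mul, Real.exp_log hM0]

/-! ### Paths -/

theorem forall_lt_of_forall_ne {u : ℝ → ℝ} {T r : ℝ} (hu : ContinuousOn u (Set.Ici T))
    (h : ∀ t, T ≤ t → u t ≠ r) {t₁ : ℝ} (ht₁ : T ≤ t₁) (h₁ : u t₁ < r) :
    ∀ t, T ≤ t → u t < r := by
  intro t ht
  by_contra hlt
  obtain ⟨t₂, ht₂, he⟩ := isPreconnected_Ici.intermediate_value (s := Set.Ici T) ht₁ ht hu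
    ⟨h₁.le, not_lt.1 hlt⟩
  exact h t₂ ht₂ he

/-- A path along which a function with isolated `s`-points converges to `s` either converges to
an `s`-point or tends to infinity. -/
theorem tendsto_or_tendsto_norm_atTop {f : ℂ → ℂ} {s : ℂ} {σ : ℝ → ℂ} {T₀ : ℝ}
    (hf : Continuous f) (hs : ∀ p, f p = s → ∀ᶠ w in 𝓝[≠] p, f w ≠ s)
    (hσ : ContinuousOn σ (Set.Ici T₀)) (h : Tendsto (fun t => f (σ t)) atTop (𝓝 s)) :
    (∃ p, f p = s ∧ Tendsto σ atTop (𝓝 p)) ∨ Tendsto (fun t => ‖σ t‖) atTop atTop := by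
  refine or_iff_not_imp_right.2 fun hn => ?_
  rw [tendsto_atTop] at hn
  push Not at hn
  obtain ⟨M, hM⟩ := hn
  have hM' : ∃ᶠ t in atTop, σ t ∈ Metric.closedBall (0 : ℂ) M :=
    hM.mono fun t ht => mem_closedBall_zero_iff.2 ht.le
  obtain ⟨p, -, hp⟩ := (isCompact_closedBall (0 : ℂ) M).exists_mapClusterPt_of_frequently hM'
  have hfp : f p = s :=
    have := (hp.continuousAt_comp hf.continuousAt).neBot.mono (inf_le_inf_left _ h)
    eq_of_nhds_neBot this
  refine ⟨p, hfp, ?_⟩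
  rw [Metric.tendsto_nhds]
  intro ε hε
  obtain ⟨δ, hδ, hball⟩ := Metric.mem_nhdsWithin_iff.1 (hs p hfp)
  set r := min (ε / 2) (δ / 2) with hr
  have hr0 : 0 < r := lt_min (by linarith) (by linarith)
  -- A small circle about the cluster point carries no `s`-point, so its image keeps a distance from
  -- `s`. The late path cannot cross it, and it is inside infinitely often.
  have hsph : s ∉ f '' Metric.sphere p r := by
    rintro ⟨w, hw, he⟩
    refine hball ⟨?_, ?_⟩ he
    · rw [Metric.mem_ball, Metric.mem_sphere.1 hw]
      exact (min_le_right _ _).trans_lt (by linarith)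
    · rintro rfl
      rw [Metric.mem_sphere, dist_self] at hw
      exact hr0.ne hw
  have hopen : (f '' Metric.sphere p r)ᶜ ∈ 𝓝 s :=
    ((isCompact_sphere p r).image hf).isClosed.isOpen_compl.mem_nhds hsph
  obtain ⟨T, hT⟩ := eventually_atTop.1 ((h.eventually hopen).and (eventually_ge_atTop T₀))
  obtain ⟨t₁, ht₁, hd⟩ := frequently_atTop.1 (hp.frequently (Metric.ball_mem_nhds p hr0)) T
  filter_upwards [eventually_ge_atTop T] with t ht
  have hlt := forall_lt_of_forall_ne (u := fun t => dist (σ t) p) (T := T) (r := r)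
    ((continuous_id.dist continuous_const).comp_continuousOn
      (hσ.mono (Set.Ici_subset_Ici.2 (hT T le_rfl).2)))
    (fun t ht he => (hT t ht).1 ⟨σ t, he, rfl⟩) ht₁ hd t ht
  exact hlt.trans_le ((min_le_left _ _).trans (by linarith))

theorem eventually_ne_of_not_const {f : ℂ → ℂ} (hf : Differentiable ℂ f) {s : ℂ}
    (h : ∃ z, f z ≠ s) (p : ℂ) : ∀ᶠ w in 𝓝[≠] p, f w ≠ s := by
  refine ((hf.analyticAt p).eventually_eq_or_eventually_ne analyticAt_const).resolve_left ?_
  intro he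
  obtain ⟨z, hz⟩ := h
  have ha : AnalyticOnNhd ℂ f Set.univ := fun z _ => hf.analyticAt z
  exact hz (congrFun (ha.eq_of_eventuallyEq (fun z _ => analyticAt_const) he) z)

/-- Uniqueness of lifts: local inverses of `Q` make the set of agreement open, and it is closed. -/
theorem eq_of_lift_eq {Q : Polynomial ℂ} {u v : ℝ → ℂ} {T : ℝ} (hu : ContinuousOn u (Set.Ici T))
    (hv : ContinuousOn v (Set.Ici T)) (h : ∀ t, T ≤ t → Q.eval (u t) = Q.eval (v t))
    (hd : ∀ t, T ≤ t → Q.derivative.eval (u t) ≠ 0) (h0 : u T = v T) :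
    ∀ t, T ≤ t → u t = v t := by
  have hu' : Continuous fun t : Set.Ici T => u t := hu.domRestrict
  have hv' : Continuous fun t : Set.Ici T => v t := hv.domRestrict
  have : PreconnectedSpace (Set.Ici T) := Subtype.preconnectedSpace isPreconnected_Ici
  have hcl : IsClopen {t : Set.Ici T | u t = v t} := by
    refine ⟨isClosed_eq hu' hv', isOpen_iff_mem_nhds.2 fun t ht => ?_⟩
    obtain ⟨L, hL⟩ : ∃ L : ℂ → ℂ, ∀ᶠ x in 𝓝 (u t), L (Q.eval x) = x :=
      ⟨_, (Q.hasStrictDerivAt (u t)).eventually_left_inverse (hd t t.2)⟩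
    have h1 := (hu'.tendsto t).eventually hL
    rw [show u t = v t from ht] at hL
    have h2 := (hv'.tendsto t).eventually hL
    filter_upwards [h1, h2] with x hx1 hx2
    rw [← hx1, ← hx2, h x x.2]
  intro t ht
  have := hcl.eq_univ ⟨⟨T, Set.self_mem_Ici⟩, h0⟩
  exact this.ge (Set.mem_univ (⟨t, ht⟩ : Set.Ici T))

/-- Inverse branches of a polynomial on a disc without critical values. -/
theorem exists_inverse_branch {Q : Polynomial ℂ} {c y : ℂ} {r : ℝ} (hr : 0 < r)
    (hQ : ∀ z, Q.derivative.eval z = 0 → Q.eval z ∉ Metric.ball c r) (hy : Q.eval y = c) :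
    ∃ G : ℂ → ℂ, DifferentiableOn ℂ G (Metric.ball c r) ∧ G c = y ∧
      (∀ w ∈ Metric.ball c r, Q.eval (G w) = w) ∧ ∀ w ∈ Metric.ball c r, deriv G w ≠ 0 := by
  classical
  set U := Metric.ball c r
  have hc : c ∈ U := Metric.mem_ball_self hr
  have : ContractibleSpace U := (convex_ball c r).contractibleSpace ⟨c, hc⟩
  have : LocallyPathConnectedSpace U := Metric.isOpen_ball.locallyPathConnectedSpace
  -- A polynomial is a covering away from its critical values, so the inclusion of the contractible
  -- disc lifts.
  obtain ⟨F, ⟨hF0, hF⟩, -⟩ := Q.isCoveringMapOn_eval.existsUnique_continuousMap_lifts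
    (⟨Subtype.val, continuous_subtype_val⟩ : C(U, ℂ)) (a₀ := ⟨c, hc⟩) (e₀ := y) hy
    (fun a => by
      rintro ⟨z, hz, he⟩
      exact hQ z hz ((show Q.eval z = a from he) ▸ a.2))
  set G : ℂ → ℂ := fun w => if hw : w ∈ U then F ⟨w, hw⟩ else 0 with hG
  have hGF : ∀ w : U, G w = F w := fun w => by simp [hG]
  have hGc : ContinuousOn G U := by
    rw [continuousOn_iff_continuous_domRestrict]
    exact F.continuous.congr fun w => (hGF w).symm
  have hGQ : ∀ w ∈ U, Q.eval (G w) = w := fun w hw => by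
    rw [hGF ⟨w, hw⟩]; exact congrFun hF ⟨w, hw⟩
  have hGd : ∀ w ∈ U, HasDerivAt G (Q.derivative.eval (G w))⁻¹ w := fun w hw =>
    HasDerivAt.of_local_left_inverse (hGc.continuousAt (Metric.isOpen_ball.mem_nhds hw))
      (Q.hasDerivAt _) (fun h => hQ _ h (by rw [hGQ w hw]; exact hw))
      (Filter.eventually_of_mem (Metric.isOpen_ball.mem_nhds hw) hGQ)
  refine ⟨G, fun w hw => (hGd w hw).differentiableAt.differentiableWithinAt,
    (hGF ⟨c, hc⟩).trans hF0, hGQ, fun w hw => ?_⟩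
  rw [(hGd w hw).deriv]
  exact inv_ne_zero fun h => hQ _ h (by rw [hGQ w hw]; exact hw)

/-! ### `chainFun` has no finite asymptotic values -/

/-- The composition of the first `n` polynomials. -/
noncomputable def chainComp (k : ℕ → ℕ) : ℕ → Polynomial ℂ
  | 0 => Polynomial.X
  | n + 1 => (chainComp k n).comp (chainPoly (k n))

theorem chainComp_eval_chainTail (k : ℕ → ℕ) (n : ℕ) (z : ℂ) :
    (chainComp k n).eval (chainTail k n z) = chainFun k z := by
  induction n with
  | zero => simp [chainComp, chainTail_zero]
  | succ n ih => rw [chainComp, Polynomial.eval_comp, ← chainTail_eq, ih]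

theorem chainComp_eval_zero_one (k : ℕ → ℕ) (n : ℕ) {z : ℂ} (h : z = 0 ∨ z = 1) :
    (chainComp k n).eval z = 0 ∨ (chainComp k n).eval z = 1 := by
  induction n with
  | zero => simpa [chainComp] using h
  | succ n ih =>
    rw [chainComp, Polynomial.eval_comp]
    rcases h with rfl | rfl
    · rwa [chainPoly_eval_zero]
    · rwa [chainPoly_eval_one]

theorem chainComp_critical (k : ℕ → ℕ) (n : ℕ) {z : ℂ}
    (h : (chainComp k n).derivative.eval z = 0) :
    (chainComp k n).eval z = 0 ∨ (chainComp k n).eval z = 1 := by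
  induction n generalizing z with
  | zero => simp [chainComp] at h
  | succ n ih =>
    rw [chainComp, Polynomial.derivative_comp, Polynomial.eval_mul, Polynomial.eval_comp,
      mul_eq_zero] at h
    rw [chainComp, Polynomial.eval_comp]
    rcases h with h | h
    · exact chainComp_eval_zero_one k n (chainPoly_critical h)
    · exact ih h

theorem norm_le_norm_chainComp (k : ℕ → ℕ) (n : ℕ) {z : ℂ} (hz : 1 ≤ ‖z‖) :
    ‖z‖ ≤ ‖(chainComp k n).eval z‖ := by
  induction n generalizing z with
  | zero => simp [chainComp]
  | succ n ih =>
    rw [chainComp, Polynomial.eval_comp]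
    have h := norm_le_norm_chainPoly (k := k n) hz
    exact h.trans (ih (hz.trans h))

/-- For large `n` the path starts inside the circle of radius `chainScale k n / 12` and must cross
it; there the tail is at distance at least `1/16` from 1. -/
theorem eventually_exists_far {γ : ℝ → ℂ} {T : ℝ} (k : ℕ → ℕ) (hγ : ContinuousOn γ (Set.Ici T))
    (hinf : Tendsto (fun t => ‖γ t‖) atTop atTop) :
    ∀ᶠ n in atTop, ∃ t, T ≤ t ∧ 1 / 16 ≤ ‖chainTail k n (γ t) - 1‖ := by
  filter_upwards [(tendsto_chainScale k).eventually_gt_atTop (12 * ‖γ T‖)] with n hn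
  have hpos := chainScale_pos k n
  by_contra hcon
  push Not at hcon
  have hlt := forall_lt_of_forall_ne (u := fun t => ‖γ t‖) (r := chainScale k n / 12)
    (continuous_norm.comp_continuousOn hγ) (fun t ht he => by
      have h1 : ‖γ t / chainScale k n‖ = 1 / 12 := by
        rw [norm_div_chainScale, he]; field_simp
      exact absurd (sixteenth_le_norm_chainFun_sub_one (fun i => k (i + n)) h1)
        (not_le.2 (hcon t ht))) le_rfl (by linarith)
  obtain ⟨t, ht, hTt⟩ := ((hinf.eventually_ge_atTop (chainScale k n / 12)).and
    (eventually_ge_atTop T)).exists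
  exact absurd (hlt t hTt) (not_lt.2 ht)

theorem not_asymptotic_of_regular {k : ℕ → ℕ} {γ : ℝ → ℂ} {s : ℂ} (hs0 : s ≠ 0) (hs1 : s ≠ 1)
    (hγ : ContinuousOn γ (Set.Ici 0)) (hinf : Tendsto (fun t => ‖γ t‖) atTop atTop) :
    ¬ Tendsto (fun t => chainFun k (γ t)) atTop (𝓝 s) := by
  intro h
  obtain ⟨ρ, hρ, hball⟩ : ∃ ρ > 0, ∀ w ∈ Metric.ball s ρ, w ≠ 0 ∧ w ≠ 1 :=
    Metric.eventually_nhds_iff_ball.1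
      ((continuous_id.tendsto s).eventually_ne hs0 |>.and
        ((continuous_id.tendsto s).eventually_ne hs1))
  obtain ⟨T, hT⟩ := eventually_atTop.1
    ((h.eventually (Metric.ball_mem_nhds s (by positivity : 0 < ρ / 16))).and
      (eventually_ge_atTop 0))
  have hT0 : 0 ≤ T := (hT T le_rfl).2
  have hγT := hγ.mono (Set.Ici_subset_Ici.2 hT0)
  set r := ρ / 2 with hr
  have hr0 : 0 < r := by positivity
  set c := chainFun k (γ T) with hc
  have hcs : dist c s < ρ / 16 := (hT T le_rfl).1
  have hsub : Metric.ball c r ⊆ Metric.ball s ρ := fun w hw => by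
    have := dist_triangle w c s
    rw [Metric.mem_ball] at *
    linarith
  have hmem : ∀ t, T ≤ t → chainFun k (γ t) ∈ Metric.ball c (r / 2 / 2) := fun t ht => by
    have h1 := dist_triangle_right (chainFun k (γ t)) c s
    have h2 := Metric.mem_ball.1 (hT t ht).1
    rw [Metric.mem_ball]
    linarith
  have hbr2 : Metric.ball c (r / 2 / 2) ⊆ Metric.ball c (r / 2) :=
    Metric.ball_subset_ball (by linarith)
  have hbr : Metric.ball c (r / 2) ⊆ Metric.ball c r := Metric.ball_subset_ball (by linarith)
  set R := ‖c‖ + r + 1 with hR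
  have hR0 : 0 < R := by positivity
  have hbranch : ∀ n, ∃ G : ℂ → ℂ, DifferentiableOn ℂ G (Metric.ball c r) ∧
      G c = chainTail k n (γ T) ∧ (∀ w ∈ Metric.ball c r, (chainComp k n).eval (G w) = w) ∧
      ∀ w ∈ Metric.ball c r, deriv G w ≠ 0 := fun n =>
    exists_inverse_branch hr0 (fun z hz hz' => by
      have h1 := hball _ (hsub hz')
      exact (chainComp_critical k n hz).elim h1.1 h1.2) (chainComp_eval_chainTail k n _)
  choose G hGd hGc hGQ hG' using hbranch
  -- The compositions do not decrease the modulus outside the unit disc, so the bound is independent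
  -- of `n`.
  have hGR : ∀ n, ∀ w ∈ Metric.ball c r, ‖G n w‖ ≤ R := fun n w hw => by
    rcases le_total ‖G n w‖ 1 with h1 | h1
    · linarith [norm_nonneg c]
    · have h2 := norm_le_norm_chainComp k n h1
      rw [hGQ n w hw] at h2
      have h3 := norm_le_norm_sub_add w c
      rw [mem_ball_iff_norm] at hw
      linarith
  have hpath : ∀ n t, T ≤ t → chainTail k n (γ t) = G n (chainFun k (γ t)) := fun n => by
    have hcont : ContinuousOn (fun t => chainFun k (γ t)) (Set.Ici T) :=
      (differentiable_chainFun k).continuous.comp_continuousOn hγT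
    refine eq_of_lift_eq (Q := chainComp k n)
      ((differentiable_chainTail k n).continuous.comp_continuousOn hγT)
      ((hGd n).continuousOn.comp hcont fun t ht => hbr (hbr2 (hmem t ht))) (fun t ht => ?_)
      (fun t ht h0 => ?_) (hGc n).symm
    · rw [chainComp_eval_chainTail, hGQ n _ (hbr (hbr2 (hmem t ht)))]
    · have h1 := chainComp_critical k n h0
      rw [chainComp_eval_chainTail] at h1
      have h2 := hball _ (hsub (hbr (hbr2 (hmem t ht))))
      exact h1.elim h2.1 h2.2
  have hder : Tendsto (fun n => deriv (G n) c) atTop (𝓝 0) := by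
    have hcb := hball c (hsub (Metric.mem_ball_self hr0))
    have hf' : deriv (chainFun k) (γ T) ≠ 0 := by
      have := deriv_chainTail_ne_zero (k := k) (n := 0) (z := γ T)
      rw [chainTail_zero] at this
      exact this hcb.1 hcb.2
    -- Chain rule for `chainComp ∘ G n = id` and `chainComp ∘ chainTail = chainFun`.
    have e : ∀ n, deriv (G n) c = deriv (chainTail k n) (γ T) / deriv (chainFun k) (γ T) := fun n => by
      have hcr := Metric.isOpen_ball.mem_nhds (Metric.mem_ball_self hr0 : c ∈ Metric.ball c r)
      have h1 := ((chainComp k n).hasDerivAt (G n c)).comp c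
        ((hGd n).differentiableAt hcr).hasDerivAt
      have h2 := h1.unique ((hasDerivAt_id c).congr_of_eventuallyEq
        (eventually_of_mem hcr (hGQ n)))
      have h3 := ((chainComp k n).hasDerivAt (chainTail k n (γ T))).comp (γ T)
        ((differentiable_chainTail k n) (γ T)).hasDerivAt
      have h4 := h3.unique ((differentiable_chainFun k (γ T)).hasDerivAt.congr_of_eventuallyEq
        (.of_forall (chainComp_eval_chainTail k n)))
      rw [hGc] at h2
      rw [← h4, eq_div_iff (h4 ▸ hf'), mul_comm, mul_right_comm, h2, one_mul]
    simp only [e]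
    simpa using (tendsto_deriv_chainTail k (γ T)).div_const (deriv (chainFun k) (γ T))
  set M := R / (r / 2) + 1 with hM
  have hM0 : 0 < M := by positivity
  have hGM : ∀ n, ∀ w ∈ Metric.ball c (r / 2), ‖deriv (G n) w‖ < M := fun n w hw => by
    have hwb : Metric.closedBall w (r / 2) ⊆ Metric.ball c r := fun z hz => by
      have := dist_triangle z w c
      rw [Metric.mem_ball] at *
      rw [Metric.mem_closedBall] at hz
      linarith
    have h1 := Complex.norm_deriv_le_of_forall_mem_sphere_norm_le (c := w) (R := r / 2) (C := R)
      (by positivity) (((hGd n).mono hwb).diffContOnCl_ball subset_rfl)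
      (fun z hz => hGR n z (hwb (Metric.sphere_subset_closedBall hz)))
    linarith
  have hG3 : ∀ n, ∀ w ∈ Metric.ball c (r / 2 / 2), ‖deriv (G n) w‖ ^ 3 ≤
      M ^ 2 * ‖deriv (G n) c‖ := fun n w hw =>
    norm_pow_three_le (((hGd n).deriv Metric.isOpen_ball).mono hbr)
      (fun w hw => hG' n w (hbr hw)) (hGM n) hw
  -- Chosen so that `G n` moves points of the smallest disc by at most `1/32` from `G n c`. Since `G
  -- n c` is eventually within `1/32` of 1, the path stays within `1/16` of 1.
  set ε := 1 / (32 * (r / 2 / 2)) with hε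
  have hε0 : 0 < ε := by positivity
  have hsmall : ∀ᶠ n in atTop, ∀ w ∈ Metric.ball c (r / 2 / 2), ‖deriv (G n) w‖ ≤ ε := by
    have h1 : Tendsto (fun n => M ^ 2 * ‖deriv (G n) c‖) atTop (𝓝 0) := by
      simpa using hder.norm.const_mul (M ^ 2)
    filter_upwards [h1.eventually (gt_mem_nhds (by positivity : 0 < ε ^ 3))] with n hn w hw
    exact le_of_pow_le_pow_left₀ three_ne_zero hε0.le ((hG3 n w hw).trans hn.le)
  have hone : ∀ᶠ n in atTop, ‖chainTail k n (γ T) - 1‖ < 1 / 32 := by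
    have := (tendsto_chainTail k (γ T)).eventually
      (Metric.ball_mem_nhds 1 (by norm_num : (0 : ℝ) < 1 / 32))
    simpa [dist_eq_norm] using this
  obtain ⟨n, hn1, hn2, t, ht, hn3⟩ :=
    (hsmall.and (hone.and (eventually_exists_far k hγT hinf))).exists
  have hmv := (convex_ball c (r / 2 / 2)).norm_image_sub_le_of_norm_deriv_le (f := G n)
    (fun w hw => (hGd n).differentiableAt (Metric.isOpen_ball.mem_nhds (hbr (hbr2 hw)))) hn1
    (Metric.mem_ball_self (by positivity)) (hmem t ht)
  rw [hGc, ← hpath n t ht] at hmv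
  have h5 : ‖chainFun k (γ t) - c‖ < r / 2 / 2 := mem_ball_iff_norm.1 (hmem t ht)
  have h6 : ε * (r / 2 / 2) = 1 / 32 := by rw [hε]; field_simp
  have h7 : ε * ‖chainFun k (γ t) - c‖ ≤ ε * (r / 2 / 2) := by gcongr
  have h8 := norm_sub_le_norm_sub_add_norm_sub (chainTail k n (γ t)) (chainTail k n (γ T)) 1
  linarith

/-- If one tail stays in the unit disc, the next cannot cross the circle through its critical point,
so it stays below `1/3`. The same starting time works for all tails, yet at a fixed point the tails
tend to 1. -/
theorem not_asymptotic_of_tendsto_zero {k : ℕ → ℕ} {γ : ℝ → ℂ}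
    (hγ : ContinuousOn γ (Set.Ici 0)) :
    ¬ ∀ n, Tendsto (fun t => chainTail k n (γ t)) atTop (𝓝 0) := by
  intro h
  have hev : ∀ (n : ℕ) {ε : ℝ}, 0 < ε → ∀ᶠ t in atTop, ‖chainTail k n (γ t)‖ < ε := fun n ε hε => by
    simpa using (h n).eventually (Metric.ball_mem_nhds 0 hε)
  obtain ⟨T, hT⟩ := eventually_atTop.1 ((hev 0 one_pos).and (eventually_ge_atTop 0))
  have hγT := hγ.mono (Set.Ici_subset_Ici.2 (hT T le_rfl).2)
  have hstep : ∀ n, (∀ t, T ≤ t → ‖chainTail k n (γ t)‖ < 1) →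
      ∀ t, T ≤ t → ‖chainTail k (n + 1) (γ t)‖ < 1 / 3 := fun n hn t ht => by
    obtain ⟨t₁, h1, h2⟩ := ((hev (n + 1) (chainCrit_pos (k n))).and (eventually_ge_atTop T)).exists
    refine (forall_lt_of_forall_ne (u := fun t => ‖chainTail k (n + 1) (γ t)‖)
      (continuous_norm.comp_continuousOn
        ((differentiable_chainTail k _).continuous.comp_continuousOn hγT))
      (fun t ht he => ?_) h2 h1 t ht).trans (chainCrit_lt (k n))
    have := hn t ht
    rw [chainTail_eq] at this
    exact absurd (one_le_norm_chainPoly he) (not_le.2 this)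
  have hall : ∀ n, ∀ t, T ≤ t → ‖chainTail k n (γ t)‖ < 1 := fun n => by
    induction n with
    | zero => exact fun t ht => (hT t ht).1
    | succ n ih => exact fun t ht => (hstep n ih t ht).trans (by norm_num)
  have h1 := le_of_tendsto ((tendsto_add_atTop_iff_nat 1).2 (tendsto_chainTail k (γ T))).norm
    (.of_forall fun n => (hstep n (hall n) T le_rfl).le)
  norm_num at h1

/-- With `λ` the multiplier, the circle of radius `1 / (4λ)` about 1 is mapped to distance at least
`1/4 - 1/8 = 1/8` from 1, so it acts as a barrier. Its radius is at most `1/20 < 1/16`, which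
contradicts `eventually_exists_far`. -/
theorem not_asymptotic_of_tendsto_one {k : ℕ → ℕ} {γ : ℝ → ℂ}
    (hγ : ContinuousOn γ (Set.Ici 0)) (hinf : Tendsto (fun t => ‖γ t‖) atTop atTop) :
    ¬ ∀ n, Tendsto (fun t => chainTail k n (γ t)) atTop (𝓝 1) := by
  intro h
  have hev : ∀ (n : ℕ) {ε : ℝ}, 0 < ε → ∀ᶠ t in atTop, ‖chainTail k n (γ t) - 1‖ < ε :=
    fun n ε hε => by
      simpa [dist_eq_norm] using (h n).eventually (Metric.ball_mem_nhds 1 hε)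
  obtain ⟨T, hT⟩ := eventually_atTop.1
    ((hev 0 (by norm_num : (0 : ℝ) < 1 / 8)).and (eventually_ge_atTop 0))
  have hγT := hγ.mono (Set.Ici_subset_Ici.2 (hT T le_rfl).2)
  have hstep : ∀ n, (∀ t, T ≤ t → ‖chainTail k n (γ t) - 1‖ < 1 / 8) →
      ∀ t, T ≤ t → ‖chainTail k (n + 1) (γ t) - 1‖ < 1 / 16 := fun n hn t ht => by
    have hl := chainMult_pos (k n)
    have hl5 := five_le_chainMult (k n)
    obtain ⟨t₁, h1, h2⟩ := ((hev (n + 1) (by positivity : 0 < 1 / (4 * chainMult (k n)))).and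
      (eventually_ge_atTop T)).exists
    refine (forall_lt_of_forall_ne (u := fun t => ‖chainTail k (n + 1) (γ t) - 1‖)
      (continuous_norm.comp_continuousOn
        (((differentiable_chainTail k _).continuous.comp_continuousOn hγT).sub continuousOn_const))
      (fun t ht he => ?_) h2 h1 t ht).trans_le ?_
    · have h3 := hn t ht
      rw [chainTail_eq] at h3
      set v := chainTail k (n + 1) (γ t) - 1 with hv
      have hv1 : chainMult (k n) * ‖v‖ = 1 / 4 := by rw [he]; field_simp
      have h4 := norm_chainPoly_sub_sub_le (k n) (M := 1 / 4) (by norm_num) hv1.le (w := 0)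
        (by simp)
      simp only [hv, add_sub_cancel, add_zero, chainPoly_eval_one, sub_zero] at h4
      rw [← hv, mul_assoc _ (chainMult (k n)), hv1, norm_sub_rev] at h4
      have h5 := norm_sub_norm_le ((chainMult (k n) : ℂ) * v)
        ((chainPoly (k n)).eval (chainTail k (n + 1) (γ t)) - 1)
      rw [norm_mul, Complex.norm_real, Real.norm_of_nonneg hl.le, hv1] at h5
      linarith
    · rw [div_le_div_iff₀ (by positivity) (by norm_num)]; linarith
  have hall : ∀ n, ∀ t, T ≤ t → ‖chainTail k n (γ t) - 1‖ < 1 / 8 := fun n => by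
    induction n with
    | zero => exact fun t ht => (hT t ht).1
    | succ n ih => exact fun t ht => (hstep n ih t ht).trans (by norm_num)
  obtain ⟨n, ⟨t, ht, h1⟩, hn⟩ :=
    ((eventually_exists_far k hγT hinf).and (eventually_ge_atTop 1)).exists
  obtain ⟨n, rfl⟩ := Nat.exists_eq_add_of_le' hn
  exact absurd (hstep n (hall n) t ht) (not_lt.2 h1)

/-- The polynomial is proper with discrete fibres, so convergence of the image path forces
convergence of the path. -/
theorem exists_tendsto_of_chainPoly {k : ℕ} {s : ℂ} {σ : ℝ → ℂ} (hσ : ContinuousOn σ (Set.Ici 0))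
    (h : Tendsto (fun t => (chainPoly k).eval (σ t)) atTop (𝓝 s)) :
    ∃ p, (chainPoly k).eval p = s ∧ Tendsto σ atTop (𝓝 p) := by
  refine (tendsto_or_tendsto_norm_atTop (chainPoly k).continuous
    (fun p _ => eventually_ne_of_not_const (chainPoly k).differentiable ?_ p) hσ h).resolve_right
    fun hinf => ?_
  · by_contra! hcon
    have h1 := (hcon 0).trans (hcon 1).symm
    rw [chainPoly_eval_zero, chainPoly_eval_one] at h1
    exact zero_ne_one h1
  · refine not_tendsto_nhds_of_tendsto_atTop (tendsto_atTop_mono' _ ?_ hinf) ‖s‖ h.norm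
    filter_upwards [hinf.eventually_ge_atTop 1] with t ht
    exact norm_le_norm_chainPoly ht

theorem asymptoticValues_chainFun (k : ℕ → ℕ) : asymptoticValues (chainFun k) = ∅ := by
  refine Set.eq_empty_iff_forall_notMem.2 fun s ⟨γ, hγ, hinf, h⟩ => ?_
  have hcont : ∀ n, ContinuousOn (fun t => chainTail k n (γ t)) (Set.Ici 0) := fun n =>
    (differentiable_chainTail k n).continuous.comp_continuousOn hγ
  have hp : ∀ n, ∃ p, Tendsto (fun t => chainTail k n (γ t)) atTop (𝓝 p) := fun n => by
    induction n with
    | zero => exact ⟨s, by simpa only [chainTail_zero] using h⟩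
    | succ n ih =>
      obtain ⟨p, hp⟩ := ih
      simp only [chainTail_eq k n] at hp
      obtain ⟨q, -, hq⟩ := exists_tendsto_of_chainPoly (hcont (n + 1)) hp
      exact ⟨q, hq⟩
  choose p hp using hp
  have hrec : ∀ n, p n = (chainPoly (k n)).eval (p (n + 1)) := fun n =>
    tendsto_nhds_unique (hp n) (by
      simp only [chainTail_eq k n]
      exact ((chainPoly (k n)).continuous.tendsto _).comp (hp (n + 1)))
  by_cases hex : ∃ n, p n ≠ 0 ∧ p n ≠ 1
  · obtain ⟨n, h0, h1⟩ := hex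
    have hpos := chainScale_pos k n
    refine not_asymptotic_of_regular (k := fun i => k (i + n))
      (γ := fun t => γ t / chainScale k n) h0 h1 (hγ.div_const _) ?_ (hp n)
    simp only [norm_div_chainScale]
    exact hinf.atTop_div_const hpos
  · push Not at hex
    -- Both 0 and 1 are fixed by every factor, so the limits cannot switch between them.
    have hconst : ∀ n, p n = p 0 := fun n => by
      induction n with
      | zero => rfl
      | succ n ih =>
        rw [← ih, hrec n]
        rcases eq_or_ne (p (n + 1)) 0 with h0 | h0
        · rw [h0, chainPoly_eval_zero]
        · rw [hex _ h0, chainPoly_eval_one]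
    rcases eq_or_ne (p 0) 0 with h0 | h0
    · exact not_asymptotic_of_tendsto_zero hγ fun n => by
        simpa only [hconst n, h0] using hp n
    · exact not_asymptotic_of_tendsto_one hγ hinf fun n => by
        simpa only [hconst n, hex 0 h0] using hp n

/-! ### Realization of sets of local degrees -/

/-- The set of the local degrees `2 (k i + 1)`. -/
def chainDegrees (k : ℕ → ℕ) : Set ℕ∞ := Set.range fun i => ((2 * (k i + 1) : ℕ) : ℕ∞)

theorem localDegree_chainFun_mem {k : ℕ → ℕ} {z : ℂ} (h : chainFun k z = 0) :
    localDegree (chainFun k) z ∈ chainDegrees k := by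
  have := localDegree_chainTail_cases k 0 z
  rw [chainTail_zero] at this
  rcases this with ⟨h0, -⟩ | ⟨h0, -⟩ | ⟨-, i, hi⟩
  · exact absurd h h0
  · rw [h] at h0; exact absurd h0 zero_ne_one
  · exact ⟨i, hi.symm⟩

theorem localDegree_chainFun_of_one {k : ℕ → ℕ} {z : ℂ} (h : chainFun k z = 1)
    (hd : deriv (chainFun k) z = 0) : localDegree (chainFun k) z = 2 := by
  have := localDegree_chainTail_cases k 0 z
  rw [chainTail_zero] at this
  rcases this with ⟨-, h1⟩ | ⟨-, h1⟩ | ⟨h0, -⟩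
  · exact absurd hd (deriv_ne_zero_of_localDegree ((differentiable_chainFun k).analyticAt z) h1)
  · exact h1
  · rw [h] at h0; exact absurd h0 one_ne_zero

theorem realizes_chainFun (k : ℕ → ℕ) : Realizes (chainDegrees k) (chainFun k) where
  entire := differentiable_chainFun k
  sing_eq := by rw [singInv, criticalValues_chainFun, asymptoticValues_chainFun, Set.union_empty]
  simple_over_one _ h hd := localDegree_chainFun_of_one h hd
  not_asymptotic_one := by rw [asymptoticValues_chainFun]; exact Set.notMem_empty _
  degrees_eq := by
    ext d
    constructor
    · rintro (⟨z, hz, rfl⟩ | ⟨-, h⟩)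
      · exact localDegree_chainFun_mem hz
      · rw [asymptoticValues_chainFun] at h; exact h.elim
    · rintro ⟨i, rfl⟩
      exact .inl ⟨chainPt k i, chainFun_chainPt k i, localDegree_chainFun_chainPt k i⟩

theorem transcendental_chainFun (k : ℕ → ℕ) : TranscendentalEntire (chainFun k) := by
  refine ⟨differentiable_chainFun k, fun ⟨p, hp⟩ => ?_⟩
  have h0 : p = 0 := Polynomial.eq_zero_of_infinite_isRoot p
    ((Set.infinite_range_of_injective (chainPt_injective k)).mono (by
      rintro _ ⟨n, rfl⟩
      exact (hp _).symm.trans (chainFun_chainPt k n)))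
  have h1 := hp 0
  rw [h0, chainFun_zero, Polynomial.eval_zero] at h1
  exact one_ne_zero h1

theorem transcendental_of_asymptotic {f : ℂ → ℂ} {s z : ℂ} (hf : Differentiable ℂ f)
    (hs : s ∈ asymptoticValues f) (hz : f z ≠ s) : TranscendentalEntire f := by
  refine ⟨hf, fun ⟨p, hp⟩ => ?_⟩
  obtain ⟨γ, -, hinf, h⟩ := hs
  by_cases hdeg : 0 < p.degree
  · have h1 := p.tendsto_norm_atTop hdeg hinf
    simp only [← hp] at h1
    exact not_tendsto_nhds_of_tendsto_atTop h1 _ h.norm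
  · rw [Polynomial.eq_C_of_degree_le_zero (not_lt.1 hdeg)] at hp
    simp only [Polynomial.eval_C] at hp
    simp only [hp] at h
    exact hz ((hp z).trans (tendsto_nhds_unique tendsto_const_nhds h))

/-- The real part of `γ` converges to `log ‖q‖`. Its imaginary part is trapped between zeros of a
cosine, as `exp γ / q` eventually has positive real part; so `γ` would be bounded. -/
theorem not_tendsto_exp_of_ne_zero {γ : ℝ → ℂ} {q : ℂ} (hγ : ContinuousOn γ (Set.Ici 0))
    (hinf : Tendsto (fun t => ‖γ t‖) atTop atTop) (hq : q ≠ 0) :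
    ¬ Tendsto (fun t => Complex.exp (γ t)) atTop (𝓝 q) := by
  intro h
  have hre : Tendsto (fun t => (γ t).re) atTop (𝓝 (Real.log ‖q‖)) := by
    have := (Real.continuousAt_log (norm_ne_zero_iff.2 hq)).tendsto.comp h.norm
    simpa [Function.comp_def, Complex.norm_exp] using this
  have hone : Tendsto (fun t => (Complex.exp (γ t) / q).re) atTop (𝓝 1) := by
    have := (Complex.continuous_re.tendsto _).comp (h.div_const q)
    rwa [div_self hq, Complex.one_re] at this
  obtain ⟨T, hT⟩ := eventually_atTop.1 ((hone.eventually (lt_mem_nhds one_pos)).and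
    (eventually_ge_atTop 0))
  have hγT := hγ.mono (Set.Ici_subset_Ici.2 (hT T le_rfl).2)
  set x : ℝ → ℝ := fun t => (γ t - Complex.log q).im with hx
  have hcos : ∀ t, T ≤ t → Real.cos (x t) ≠ 0 := fun t ht h0 => by
    have h1 := (hT t ht).1
    rw [← Complex.exp_log hq, ← Complex.exp_sub, Complex.exp_re] at h1
    rw [show (γ t - Complex.log q).im = x t from rfl, h0, mul_zero] at h1
    exact lt_irrefl _ h1
  obtain ⟨j, hj⟩ := exists_nat_gt (|x T| / Real.pi)
  rw [div_lt_iff₀ Real.pi_pos] at hj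
  have hlt := forall_lt_of_forall_ne (u := fun t => |x t|) (r := (2 * j + 1) * Real.pi / 2)
    (continuous_abs.comp_continuousOn (Complex.continuous_im.comp_continuousOn
      (hγT.sub continuousOn_const))) (fun t ht he => hcos t ht (by
        rw [← Real.cos_abs, Real.cos_eq_zero_iff]
        exact ⟨j, by exact_mod_cast he⟩)) le_rfl (by
        have := Real.pi_pos
        have : (0 : ℝ) ≤ j := j.cast_nonneg
        show |x T| < _
        linarith)
  have hbd : ∀ᶠ t in atTop, ‖γ t‖ ≤
      |Real.log ‖q‖| + 1 + ((2 * j + 1) * Real.pi / 2 + |(Complex.log q).im|) := by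
    filter_upwards [hre.abs.eventually (gt_mem_nhds (lt_add_one _)), eventually_ge_atTop T]
      with t h1 h2
    refine (Complex.norm_le_abs_re_add_abs_im _).trans (add_le_add h1.le ?_)
    have h3 := hlt t h2
    have h4 := abs_add_le (x t) (Complex.log q).im
    rw [show x t + (Complex.log q).im = (γ t).im by simp [hx]] at h4
    linarith
  obtain ⟨t, h1, h2⟩ := (hbd.and (hinf.eventually_gt_atTop
    (|Real.log ‖q‖| + 1 + ((2 * j + 1) * Real.pi / 2 + |(Complex.log q).im|)))).exists
  exact absurd h1 (not_le.2 h2)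

/-! #### The set `{∞}` -/

theorem hasDerivAt_exp_sq (z : ℂ) :
    HasDerivAt (fun z => Complex.exp (z ^ 2)) (Complex.exp (z ^ 2) * (2 * z)) z := by
  simpa using (hasDerivAt_pow 2 z).cexp

theorem asymptoticValues_exp_sq : asymptoticValues (fun z => Complex.exp (z ^ 2)) = {0} := by
  ext s
  constructor
  · rintro ⟨γ, hγ, hinf, h⟩
    by_contra hs
    refine not_tendsto_exp_of_ne_zero (γ := fun t => γ t ^ 2) (hγ.pow 2) ?_ hs h
    simp only [norm_pow]
    exact (tendsto_pow_atTop two_ne_zero).comp hinf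
  · rintro rfl
    refine ⟨fun t => t * Complex.I, by fun_prop, ?_, ?_⟩
    · simpa using tendsto_abs_atTop_atTop
    · rw [tendsto_zero_iff_norm_tendsto_zero]
      have : Tendsto (fun t : ℝ => Real.exp (-t ^ 2)) atTop (𝓝 0) :=
        Real.tendsto_exp_neg_atTop_nhds_zero.comp (tendsto_pow_atTop two_ne_zero)
      refine this.congr fun t => ?_
      rw [Complex.norm_exp, mul_pow, Complex.I_sq, ← Complex.ofReal_pow]
      rw [mul_neg_one, Complex.neg_re, Complex.ofReal_re]

theorem exp_sq_critical {z : ℂ} (h : deriv (fun z => Complex.exp (z ^ 2)) z = 0) : z = 0 := by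
  simpa [(hasDerivAt_exp_sq z).deriv, Complex.exp_ne_zero] using h

theorem realizes_exp_sq : Realizes {⊤} (fun z => Complex.exp (z ^ 2)) where
  entire z := (hasDerivAt_exp_sq z).differentiableAt
  sing_eq := by
    have : criticalValues (fun z => Complex.exp (z ^ 2)) = {1} := by
      ext s
      constructor
      · rintro ⟨z, hz, rfl⟩
        simp [exp_sq_critical hz]
      · rintro rfl
        exact ⟨0, by simp [(hasDerivAt_exp_sq 0).deriv], by simp⟩
    rw [singInv, this, asymptoticValues_exp_sq, Set.union_comm]
    rfl
  simple_over_one z _ hd := by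
    have h2 : localDegree (fun z : ℂ => z ^ 2) 0 = (2 : ℕ) := by
      have ha : AnalyticAt ℂ (fun w : ℂ => w ^ 2 - 0 ^ 2) 0 := by fun_prop
      rw [localDegree, ha.analyticOrderAt_eq_natCast]
      exact ⟨fun _ => 1, by fun_prop, one_ne_zero, .of_forall fun z => by simp⟩
    rw [exp_sq_critical hd, localDegree_comp (f := Complex.exp) (g := fun z => z ^ 2) (by fun_prop)
      (by fun_prop), h2, localDegree_eq_one (by fun_prop) (by simp), one_mul]
    rfl
  not_asymptotic_one := by rw [asymptoticValues_exp_sq]; exact one_ne_zero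
  degrees_eq := by
    ext d
    simp [degreesOver, asymptoticValues_exp_sq, Complex.exp_ne_zero]

theorem transcendental_exp_sq : TranscendentalEntire (fun z => Complex.exp (z ^ 2)) :=
  transcendental_of_asymptotic (s := 0) (z := 0) realizes_exp_sq.entire
    (by rw [asymptoticValues_exp_sq]; rfl) (Complex.exp_ne_zero _)

/-! #### Sets containing `∞` and a finite degree -/

/-- The sequence `k` with its first term doubled. -/
def repeatFirst (k : ℕ → ℕ) (i : ℕ) : ℕ := k (i - 1)

/-- The precomposition of `chainFun` with an exponential function whose asymptotic value is a zero
of `chainFun`. -/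
noncomputable def chainExp (k : ℕ → ℕ) (z : ℂ) : ℂ :=
  chainFun (repeatFirst k) (chainPt (repeatFirst k) 0 + Complex.exp z)

theorem chainDegrees_repeatFirst (k : ℕ → ℕ) : chainDegrees (repeatFirst k) = chainDegrees k := by
  ext d
  constructor
  · rintro ⟨i, rfl⟩; exact ⟨i - 1, rfl⟩
  · rintro ⟨i, rfl⟩; exact ⟨i + 1, rfl⟩

theorem exists_add_exp_eq {b w : ℂ} (h : w ≠ b) : ∃ z, b + Complex.exp z = w :=
  ⟨Complex.log (w - b), by rw [Complex.exp_log (sub_ne_zero.2 h), add_sub_cancel]⟩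

theorem localDegree_chainExp (k : ℕ → ℕ) (z : ℂ) : localDegree (chainExp k) z =
    localDegree (chainFun (repeatFirst k)) (chainPt (repeatFirst k) 0 + Complex.exp z) := by
  have hd : deriv (fun z => chainPt (repeatFirst k) 0 + Complex.exp z) z ≠ 0 := by
    simp [Complex.exp_ne_zero]
  have ha : AnalyticAt ℂ (fun z => chainPt (repeatFirst k) 0 + Complex.exp z) z := by fun_prop
  have := localDegree_comp (f := chainFun (repeatFirst k))
    (g := fun z => chainPt (repeatFirst k) 0 + Complex.exp z)
    ((differentiable_chainFun _).analyticAt _) ha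
  rw [localDegree_eq_one ha hd, mul_one] at this
  exact this

theorem differentiable_chainExp (k : ℕ → ℕ) : Differentiable ℂ (chainExp k) :=
  (differentiable_chainFun _).comp ((differentiable_const _).add Complex.differentiable_exp)

theorem deriv_chainExp_eq_zero_iff {k : ℕ → ℕ} {z : ℂ} : deriv (chainExp k) z = 0 ↔
    deriv (chainFun (repeatFirst k)) (chainPt (repeatFirst k) 0 + Complex.exp z) = 0 := by
  have h1 := (differentiable_chainExp k).analyticAt z
  have h2 := (differentiable_chainFun (repeatFirst k)).analyticAt
    (chainPt (repeatFirst k) 0 + Complex.exp z)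
  have h3 := localDegree_chainExp k z
  constructor
  · intro h
    refine deriv_eq_zero_of_localDegree h2 fun he => ?_
    exact deriv_ne_zero_of_localDegree h1 (h3.trans he) h
  · intro h
    refine deriv_eq_zero_of_localDegree h1 fun he => ?_
    exact deriv_ne_zero_of_localDegree h2 (h3.symm.trans he) h

theorem exists_degree_chainExp (k : ℕ → ℕ) (i : ℕ) :
    ∃ z, chainExp k z = 0 ∧ localDegree (chainExp k) z = ((2 * (k i + 1) : ℕ) : ℕ∞) := by
  -- Only the zero of index 0 is omitted. The repeated first term shifts the indices, so the zero of
  -- index `i + 1` carries the degree `2 (k i + 1)`.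
  obtain ⟨z, hz⟩ := exists_add_exp_eq (b := chainPt (repeatFirst k) 0)
    (w := chainPt (repeatFirst k) (i + 1))
    (fun h => Nat.succ_ne_zero i (chainPt_injective _ h))
  refine ⟨z, ?_, ?_⟩
  · rw [chainExp, hz, chainFun_chainPt]
  · rw [localDegree_chainExp, hz, localDegree_chainFun_chainPt]; rfl

theorem exists_critical_one_chainExp (k : ℕ → ℕ) :
    ∃ z, chainExp k z = 1 ∧ deriv (chainExp k) z = 0 := by
  obtain ⟨w, h1, h2⟩ := exists_critical_one_chainFun (repeatFirst k)
  obtain ⟨z, hz⟩ := exists_add_exp_eq (b := chainPt (repeatFirst k) 0) (w := w) (fun h => by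
    rw [h, chainFun_chainPt] at h1
    exact zero_ne_one h1)
  refine ⟨z, by rw [chainExp, hz, h1], ?_⟩
  rw [deriv_chainExp_eq_zero_iff, hz]
  exact deriv_eq_zero_of_localDegree ((differentiable_chainFun _).analyticAt _)
    (by rw [h2]; norm_num)

theorem criticalValues_chainExp (k : ℕ → ℕ) : criticalValues (chainExp k) = {0, 1} := by
  ext s
  constructor
  · rintro ⟨z, hz, rfl⟩
    rw [← criticalValues_chainFun (repeatFirst k)]
    exact ⟨_, deriv_chainExp_eq_zero_iff.1 hz, rfl⟩
  · rintro (rfl | rfl)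
    · obtain ⟨z, h1, h2⟩ := exists_degree_chainExp k 0
      exact ⟨z, deriv_eq_zero_of_localDegree ((differentiable_chainExp k).analyticAt z)
        (by rw [h2]; exact natCast_two_mul_ne_one _), h1⟩
    · obtain ⟨z, h1, h2⟩ := exists_critical_one_chainExp k
      exact ⟨z, h2, h1⟩

/-- The image path under `b + exp` either tends to infinity, impossible as `chainFun` has no
asymptotic values, or converges; the limit must be the omitted point `b`, over which the value is 0.
-/
theorem asymptoticValues_chainExp (k : ℕ → ℕ) : asymptoticValues (chainExp k) = {0} := by
  set b := chainPt (repeatFirst k) 0 with hb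
  have hf := differentiable_chainFun (repeatFirst k)
  ext s
  constructor
  · rintro ⟨γ, hγ, hinf, h⟩
    have hσ : ContinuousOn (fun t => b + Complex.exp (γ t)) (Set.Ici 0) :=
      continuousOn_const.add hγ.cexp
    have hnc : ∃ z, chainFun (repeatFirst k) z ≠ s := by
      by_contra! hcon
      have h1 := (hcon b).trans (hcon 0).symm
      rw [chainFun_zero, chainFun_chainPt] at h1
      exact zero_ne_one h1
    rcases tendsto_or_tendsto_norm_atTop hf.continuous
      (fun p _ => eventually_ne_of_not_const hf hnc p) hσ h with ⟨p, hp, hσp⟩ | hσinf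
    · by_contra hs
      refine not_tendsto_exp_of_ne_zero (q := p - b) hγ hinf (sub_ne_zero.2 fun hpb => hs ?_)
        (by simpa using hσp.sub_const b)
      rw [← hp, hpb, hb, chainFun_chainPt]
      rfl
    · have : s ∈ asymptoticValues (chainFun (repeatFirst k)) := ⟨_, hσ, hσinf, h⟩
      rw [asymptoticValues_chainFun] at this
      exact this.elim
  · rintro rfl
    refine ⟨fun t => -t, by fun_prop, ?_, ?_⟩
    · simpa using tendsto_abs_atTop_atTop
    · have h1 : Tendsto (fun t : ℝ => Complex.exp (-t)) atTop (𝓝 0) := by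
        rw [tendsto_zero_iff_norm_tendsto_zero]
        refine Real.tendsto_exp_neg_atTop_nhds_zero.congr fun t => ?_
        rw [Complex.norm_exp]; simp
      have h2 := (hf.continuous.tendsto _).comp (h1.const_add b)
      rwa [add_zero, hb, chainFun_chainPt] at h2

theorem realizes_chainExp (k : ℕ → ℕ) : Realizes (insert ⊤ (chainDegrees k)) (chainExp k) where
  entire := differentiable_chainExp k
  sing_eq := by
    rw [singInv, criticalValues_chainExp, asymptoticValues_chainExp,
      Set.union_eq_self_of_subset_right (by simp)]
  simple_over_one z h hd := by
    rw [localDegree_chainExp]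
    exact localDegree_chainFun_of_one h (deriv_chainExp_eq_zero_iff.1 hd)
  not_asymptotic_one := by rw [asymptoticValues_chainExp]; exact one_ne_zero
  degrees_eq := by
    ext d
    constructor
    · rintro (⟨z, hz, rfl⟩ | ⟨rfl, -⟩)
      · rw [localDegree_chainExp, ← chainDegrees_repeatFirst]
        exact .inr (localDegree_chainFun_mem hz)
      · exact .inl rfl
    · rintro (rfl | ⟨i, rfl⟩)
      · exact .inr ⟨rfl, by rw [asymptoticValues_chainExp]; rfl⟩
      · exact .inl (exists_degree_chainExp k i)

theorem transcendental_chainExp (k : ℕ → ℕ) : TranscendentalEntire (chainExp k) := by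
  obtain ⟨z, h, -⟩ := exists_critical_one_chainExp k
  exact transcendental_of_asymptotic (s := 0) (z := z) (differentiable_chainExp k)
    (by rw [asymptoticValues_chainExp]; rfl) (by rw [h]; exact one_ne_zero)

theorem exists_chainDegrees_eq {A : Set ℕ∞} (hA : A ⊆ evenOrInfinite) (hne : (A \ {⊤}).Nonempty) :
    ∃ k, chainDegrees k = A \ {⊤} := by
  have hk : ∀ d ∈ A \ {⊤}, ∃ j : ℕ, d = ((2 * (j + 1) : ℕ) : ℕ∞) := fun d hd => by
    rcases hA hd.1 with h | ⟨j, hj, h⟩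
    · exact absurd h hd.2
    · exact ⟨j - 1, by rw [h, Nat.sub_add_cancel hj]⟩
  set S : Set ℕ := {j | ((2 * (j + 1) : ℕ) : ℕ∞) ∈ A \ {⊤}}
  have hS : S.Nonempty := by
    obtain ⟨d, hd⟩ := hne
    obtain ⟨j, hj⟩ := hk d hd
    exact ⟨j, show _ ∈ A \ {⊤} from hj ▸ hd⟩
  obtain ⟨k, hkS⟩ := S.to_countable.exists_eq_range hS
  refine ⟨k, ?_⟩
  ext d
  constructor
  · rintro ⟨i, rfl⟩
    exact (hkS.ge ⟨i, rfl⟩ : k i ∈ S)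
  · intro hd
    obtain ⟨j, hj⟩ := hk d hd
    obtain ⟨i, hi⟩ := hkS.le (show j ∈ S from (hj ▸ hd : _ ∈ A \ {⊤}))
    exact ⟨i, by rw [hj, ← hi]⟩

theorem exists_realizes {A : Set ℕ∞} (hne : A.Nonempty) (hA : A ⊆ evenOrInfinite) :
    ∃ f : ℂ → ℂ, TranscendentalEntire f ∧ Realizes A f := by
  rcases (A \ {⊤}).eq_empty_or_nonempty with h | h
  · have : A = {⊤} := hne.subset_singleton_iff.1 (Set.sdiff_eq_empty.1 h)
    exact ⟨_, transcendental_exp_sq, this ▸ realizes_exp_sq⟩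
  · obtain ⟨k, hk⟩ := exists_chainDegrees_eq hA h
    by_cases htop : (⊤ : ℕ∞) ∈ A
    · refine ⟨chainExp k, transcendental_chainExp k, ?_⟩
      have := realizes_chainExp k
      rwa [hk, Set.insert_sdiff_singleton, Set.insert_eq_of_mem htop] at this
    · refine ⟨chainFun k, transcendental_chainFun k, ?_⟩
      have := realizes_chainFun k
      rwa [hk, Set.sdiff_singleton_eq_self htop] at this

/-! ### Topological invariance of the local degrees -/

/-- Near `z`, the map `f` takes every value close to and different from `f z` exactly `d` times. -/
def LocallyCovers (f : ℂ → ℂ) (z : ℂ) (d : ℕ) : Prop :=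
  ∀ U ∈ 𝓝 z, ∃ U' ∈ 𝓝 z, U' ⊆ U ∧ ∃ V ∈ 𝓝 (f z), ∀ w ∈ V, w ≠ f z → (U' ∩ f ⁻¹' {w}).ncard = d

theorem LocallyCovers.le {f : ℂ → ℂ} {z : ℂ} {d d' : ℕ} (hd : d ≠ 0) (h : LocallyCovers f z d)
    (h' : LocallyCovers f z d') : d' ≤ d := by
  obtain ⟨U, hU, -, V, hV, hcard⟩ := h _ univ_mem
  obtain ⟨U', -, hUU', V', hV', hcard'⟩ := h' U hU
  obtain ⟨w, hw, hne⟩ := Filter.nonempty_of_mem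
    (inter_mem (mem_nhdsWithin_of_mem_nhds (inter_mem hV hV'))
      (self_mem_nhdsWithin (a := f z) (s := {f z}ᶜ)))
  have h1 := hcard w hw.1 hne
  rw [← h1, ← hcard' w hw.2 hne]
  exact Set.ncard_le_ncard (Set.inter_subset_inter_left _ hUU')
    -- An infinite set has `ncard` 0, so `d ≠ 0` guarantees that the larger fibre is finite.
    (Set.finite_of_ncard_ne_zero (h1.trans_ne hd))

theorem LocallyCovers.unique {f : ℂ → ℂ} {z : ℂ} {d d' : ℕ} (hd : d ≠ 0) (hd' : d' ≠ 0)
    (h : LocallyCovers f z d) (h' : LocallyCovers f z d') : d = d' :=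
  (h'.le hd' h).antisymm (h.le hd h')

theorem LocallyCovers.conj {f g : ℂ → ℂ} {φ ψ : ℂ ≃ₜ ℂ} (hg : ∀ z, g z = ψ (f (φ z))) {z : ℂ}
    {d : ℕ} (h : LocallyCovers f (φ z) d) : LocallyCovers g z d := by
  intro U hU
  obtain ⟨U', hU', hsub, V, hV, hcard⟩ := h (φ.symm ⁻¹' U)
    (φ.symm.continuous.continuousAt.preimage_mem_nhds (by simpa using hU))
  refine ⟨φ ⁻¹' U', φ.continuous.continuousAt.preimage_mem_nhds hU',
    fun x hx => by simpa using hsub hx, ψ.symm ⁻¹' V,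
    ψ.symm.continuous.continuousAt.preimage_mem_nhds (by simpa [hg] using hV), fun w hw hne => ?_⟩
  rw [← hcard _ hw (fun he => hne (by rw [hg, ← he, ψ.apply_symm_apply])),
    ← Set.ncard_image_of_injective (U' ∩ f ⁻¹' {ψ.symm w}) φ.symm.injective]
  congr 1
  ext x
  rw [φ.symm.image_eq_preimage_symm]
  simp [hg, Homeomorph.eq_symm_apply]

theorem ncard_pow_eq {d : ℕ} (hd : d ≠ 0) {a : ℂ} (ha : a ≠ 0) : {u : ℂ | u ^ d = a}.ncard = d := by
  have hζ := Complex.isPrimitiveRoot_exp d hd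
  have hex : ∃ α : ℂ, α ^ d = a := IsAlgClosed.exists_pow_nat_eq a (Nat.pos_of_ne_zero hd)
  have hcard := hζ.card_nthRoots a
  rw [if_pos hex] at hcard
  have hnd : (Polynomial.nthRoots d a).Nodup := hζ.nthRoots_nodup ha
  have : {u : ℂ | u ^ d = a} = (⟨Polynomial.nthRoots d a, hnd⟩ : Finset ℂ) := by
    ext u
    simp [Polynomial.mem_nthRoots (Nat.pos_of_ne_zero hd)]
  rw [this, Set.ncard_coe_finset]
  exact hcard

/-- An analytic function of local degree `d` is locally the `d`-th power of a local coordinate. -/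
theorem exists_local_coordinate {f : ℂ → ℂ} {z : ℂ} {d : ℕ} (hf : AnalyticAt ℂ f z) (hd : d ≠ 0)
    (h : localDegree f z = d) : ∃ h : ℂ → ℂ, AnalyticAt ℂ h z ∧ h z = 0 ∧ deriv h z ≠ 0 ∧
      ∀ᶠ w in 𝓝 z, f w = f z + h w ^ d := by
  have ha : AnalyticAt ℂ (fun w => f w - f z) z := hf.sub analyticAt_const
  obtain ⟨g, hg, hg0, hfg⟩ := ha.analyticOrderAt_eq_natCast.1 h
  obtain ⟨c, hc⟩ := IsAlgClosed.exists_pow_nat_eq (g z) (Nat.pos_of_ne_zero hd)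
  have hc0 : c ≠ 0 := by
    rintro rfl
    rw [zero_pow hd] at hc
    exact hg0 hc.symm
  -- A holomorphic `d`-th root of `g`: after division by `g z` the argument of the logarithm is near
  -- 1, away from the branch cut.
  set G : ℂ → ℂ := fun w => c * Complex.exp (Complex.log (g w / g z) / d) with hG
  have hGz : G z = c := by simp [hG, div_self hg0]
  have hGa : AnalyticAt ℂ G z := by
    refine analyticAt_const.mul (((hg.div analyticAt_const hg0).clog ?_).div analyticAt_const
      (Nat.cast_ne_zero.2 hd)).cexp
    simp [div_self hg0]
  have hderiv : deriv (fun w => (w - z) * G w) z = c := by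
    have h1 := ((hasDerivAt_id z).sub_const z).mul hGa.differentiableAt.hasDerivAt
    have h2 := h1.deriv
    simp only [id, sub_self, zero_mul, add_zero, one_mul, hGz] at h2
    exact h2
  refine ⟨fun w => (w - z) * G w, (analyticAt_id.sub analyticAt_const).mul hGa, by simp,
    by rw [hderiv]; exact hc0, ?_⟩
  filter_upwards [hfg, hg.continuousAt.eventually_ne hg0] with w hw hgw
  have hGd : G w ^ d = g w := by
    rw [hG, mul_pow, hc, ← Complex.exp_nat_mul, mul_div_cancel₀ _ (Nat.cast_ne_zero.2 hd),
      Complex.exp_log (div_ne_zero hgw hg0), mul_div_cancel₀ _ hg0]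
  rw [mul_pow, hGd, ← smul_eq_mul, ← hw]
  ring

/-- In the coordinate `h` the fibre over `w` is the set of `d`-th roots of `w - f z`; discs of
radius `ε` and `ε ^ d` correspond. -/
theorem locallyCovers_of_localDegree {f : ℂ → ℂ} {z : ℂ} {d : ℕ} (hf : AnalyticAt ℂ f z)
    (hd : d ≠ 0) (h : localDegree f z = d) : LocallyCovers f z d := by
  obtain ⟨h, hh, hz, hh', hfh⟩ := exists_local_coordinate hf hd h
  intro U hU
  have hs : HasStrictDerivAt h (deriv h z) z := hh.hasStrictDerivAt
  set e := (hs.hasStrictFDerivAt_equiv hh').toOpenPartialHomeomorph h with he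
  have hze : z ∈ e.source := (hs.hasStrictFDerivAt_equiv hh').mem_toOpenPartialHomeomorph_source
  have hcoe : ∀ x, e x = h x := fun x => rfl
  have hez : e z = 0 := hz
  set W := U ∩ {w | f w = f z + h w ^ d} with hW
  have hWz : W ∈ 𝓝 z := inter_mem hU hfh
  have hpre : e.target ∩ e.symm ⁻¹' W ∈ 𝓝 (0 : ℂ) := by
    rw [← hez]
    refine inter_mem (e.open_target.mem_nhds (e.map_source hze))
      ((e.continuousAt_symm (e.map_source hze)).preimage_mem_nhds ?_)
    rwa [e.left_inv hze]
  obtain ⟨ε, hε, hball⟩ := Metric.mem_nhds_iff.1 hpre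
  refine ⟨e.source ∩ W ∩ h ⁻¹' Metric.ball 0 ε, inter_mem (inter_mem
    (e.open_source.mem_nhds hze) hWz) (hh.continuousAt.preimage_mem_nhds
      (by rw [hz]; exact Metric.ball_mem_nhds 0 hε)), fun x hx => hx.1.2.1,
    Metric.ball (f z) (ε ^ d), Metric.ball_mem_nhds _ (by positivity), fun w hw hne => ?_⟩
  rw [← ncard_pow_eq hd (sub_ne_zero.2 hne), ← Set.InjOn.ncard_image (f := e)
    (e.injOn.mono fun x hx => hx.1.1.1)]
  congr 1
  ext u
  constructor
  · rintro ⟨x, ⟨⟨⟨-, -, hx⟩, -⟩, hxw⟩, rfl⟩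
    rw [Set.mem_preimage, Set.mem_singleton_iff] at hxw
    exact eq_sub_of_add_eq' (hx.symm.trans hxw)
  · intro hu
    replace hu : u ^ d = w - f z := hu
    have hub : u ∈ Metric.ball (0 : ℂ) ε := by
      rw [mem_ball_zero_iff]
      refine lt_of_pow_lt_pow_left₀ d hε.le ?_
      rw [← norm_pow, hu]
      exact mem_ball_iff_norm.1 hw
    have hue := hball hub
    have hinv : h (e.symm u) = u := e.right_inv hue.1
    refine ⟨e.symm u, ⟨⟨⟨e.map_target hue.1, hue.2⟩, ?_⟩, ?_⟩, e.right_inv hue.1⟩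
    · rwa [Set.mem_preimage, hinv]
    · have h1 : f (e.symm u) = f z + h (e.symm u) ^ d := hue.2.2
      rw [Set.mem_preimage, h1, hinv, hu, add_sub_cancel]
      rfl

theorem localDegree_ne_zero {f : ℂ → ℂ} {z : ℂ} (hf : AnalyticAt ℂ f z) : localDegree f z ≠ 0 :=
  AnalyticAt.analyticOrderAt_ne_zero (hf.sub analyticAt_const) |>.2 (sub_self _)

theorem localDegree_ne_top {f : ℂ → ℂ} (hf : Differentiable ℂ f) (h : ∀ s, ∃ z, f z ≠ s) (z : ℂ) :
    localDegree f z ≠ ⊤ := by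
  intro ht
  have h1 := analyticOrderAt_eq_top.1 ht
  have h2 := eventually_ne_of_not_const hf (h (f z)) z
  obtain ⟨w, hw1, hw2⟩ := ((h1.filter_mono nhdsWithin_le_nhds).and h2).exists
  exact hw2 (sub_eq_zero.1 hw1)

theorem asymptoticValues_conj {f g : ℂ → ℂ} {φ ψ : ℂ ≃ₜ ℂ} (hg : ∀ z, g z = ψ (f (φ z))) {s : ℂ}
    (h : s ∈ asymptoticValues f) : ψ s ∈ asymptoticValues g := by
  obtain ⟨γ, hγ, hinf, h⟩ := h
  refine ⟨fun t => φ.symm (γ t), φ.symm.continuous.comp_continuousOn hγ, ?_, ?_⟩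
  · rw [tendsto_norm_atTop_iff_cobounded, Metric.cobounded_eq_cocompact] at hinf ⊢
    exact φ.symm.isClosedEmbedding.tendsto_cocompact.comp hinf
  · simp only [hg, φ.apply_symm_apply]
    exact (ψ.continuous.tendsto s).comp h

theorem degreesOver_conj_subset {f g : ℂ → ℂ} {φ ψ : ℂ ≃ₜ ℂ} (hf : Differentiable ℂ f)
    (hfc : ∀ s, ∃ z, f z ≠ s) (hgd : Differentiable ℂ g) (hgc : ∀ s, ∃ z, g z ≠ s)
    (hg : ∀ z, g z = ψ (f (φ z))) (s : ℂ) : degreesOver f s ⊆ degreesOver g (ψ s) := by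
  rintro d (⟨z, hz, rfl⟩ | ⟨rfl, h⟩)
  · obtain ⟨d, hd⟩ := ENat.ne_top_iff_exists.1 (localDegree_ne_top hf hfc z)
    obtain ⟨d', hd'⟩ := ENat.ne_top_iff_exists.1 (localDegree_ne_top hgd hgc (φ.symm z))
    have ha := hf.analyticAt z
    have ha' := hgd.analyticAt (φ.symm z)
    have hd0 : d ≠ 0 := fun h => localDegree_ne_zero ha (by rw [← hd, h]; rfl)
    have hd0' : d' ≠ 0 := fun h => localDegree_ne_zero ha' (by rw [← hd', h]; rfl)
    have h1 := locallyCovers_of_localDegree ha hd0 hd.symm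
    have h2 := locallyCovers_of_localDegree ha' hd0' hd'.symm
    have h3 : LocallyCovers g (φ.symm z) d :=
      LocallyCovers.conj (f := f) hg (by rwa [φ.apply_symm_apply])
    refine .inl ⟨φ.symm z, by rw [hg, φ.apply_symm_apply, hz], ?_⟩
    rw [← hd, ← hd', h3.unique hd0 hd0' h2]
  · exact .inr ⟨rfl, asymptoticValues_conj hg h⟩

theorem topologicallyEquivalent_symm {f g : ℂ → ℂ} {φ ψ : ℂ ≃ₜ ℂ} (hg : ∀ z, g z = ψ (f (φ z)))
    (z : ℂ) : f z = ψ.symm (g (φ.symm z)) := by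
  rw [hg, φ.apply_symm_apply, ψ.symm_apply_apply]

theorem degreesOver_conj {f g : ℂ → ℂ} {φ ψ : ℂ ≃ₜ ℂ} (hf : Differentiable ℂ f)
    (hfc : ∀ s, ∃ z, f z ≠ s) (hgd : Differentiable ℂ g) (hgc : ∀ s, ∃ z, g z ≠ s)
    (hg : ∀ z, g z = ψ (f (φ z))) (s : ℂ) : degreesOver g (ψ s) = degreesOver f s := by
  refine subset_antisymm ?_ (degreesOver_conj_subset hf hfc hgd hgc hg s)
  have := degreesOver_conj_subset hgd hgc hf hfc (topologicallyEquivalent_symm hg) (ψ s)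
  rwa [ψ.symm_apply_apply] at this

/-! ### Inequivalence for different sets of degrees -/

theorem Realizes.not_const {A : Set ℕ∞} {f : ℂ → ℂ} (h : Realizes A f) (s : ℂ) : ∃ z, f z ≠ s := by
  by_contra! hcon
  have hsub : singInv f ⊆ {s} := by
    rintro w (⟨z, -, rfl⟩ | ⟨γ, -, -, hγ⟩)
    · exact hcon z
    · simp only [hcon] at hγ
      exact (tendsto_nhds_unique tendsto_const_nhds hγ).symm
  rw [h.sing_eq] at hsub
  exact zero_ne_one ((hsub (.inl rfl) : (0 : ℂ) = s).trans (hsub (.inr rfl) : (1 : ℂ) = s).symm)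

theorem one_notMem_evenOrInfinite : (1 : ℕ∞) ∉ evenOrInfinite := by
  rintro (h | ⟨k, -, h⟩)
  · exact ENat.one_ne_top h
  · exact natCast_two_mul_ne_one k h.symm

theorem mem_singInv_of_degreesOver {f : ℂ → ℂ} {s : ℂ} {d : ℕ∞} (hf : Differentiable ℂ f)
    (hd : d ∈ degreesOver f s) (h1 : d ≠ 1) : s ∈ singInv f := by
  rcases hd with ⟨z, hz, rfl⟩ | ⟨-, h⟩
  · exact .inl ⟨z, deriv_eq_zero_of_localDegree (hf.analyticAt z) h1, hz⟩
  · exact .inr h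

theorem Realizes.eq_two_of_mem {A : Set ℕ∞} {f : ℂ → ℂ} (h : Realizes A f) {d : ℕ∞}
    (hd : d ∈ degreesOver f 1) (h1 : d ≠ 1) : d = 2 := by
  rcases hd with ⟨z, hz, rfl⟩ | ⟨-, ha⟩
  · exact h.simple_over_one z hz (deriv_eq_zero_of_localDegree (h.entire.analyticAt z) h1)
  · exact absurd ha h.not_asymptotic_one

/-- Under a topological equivalence, the value `0` goes to `0`, or to `1` if all local degrees
over `0` are `2`. -/
theorem Realizes.map_zero {A B : Set ℕ∞} {f g : ℂ → ℂ} {φ ψ : ℂ ≃ₜ ℂ} (hne : A.Nonempty)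
    (hA : A ⊆ evenOrInfinite) (hf : Realizes A f) (hgB : Realizes B g)
    (hg : ∀ z, g z = ψ (f (φ z))) : (ψ 0 = 0 ∧ A = B) ∨ (ψ 0 = 1 ∧ A = {2}) := by
  have hdeg := degreesOver_conj hf.entire hf.not_const hgB.entire hgB.not_const hg 0
  rw [hf.degrees_eq] at hdeg
  have hA1 : ∀ d ∈ A, d ≠ 1 := fun d hd h => one_notMem_evenOrInfinite (h ▸ hA hd)
  obtain ⟨d, hd⟩ := hne
  have hs := mem_singInv_of_degreesOver hgB.entire (hdeg.ge hd) (hA1 d hd)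
  rw [hgB.sing_eq] at hs
  rcases hs with hs | hs
  · rw [hs, hgB.degrees_eq] at hdeg
    exact .inl ⟨hs, hdeg.symm⟩
  · replace hs : ψ 0 = 1 := hs
    rw [hs] at hdeg
    exact .inr ⟨hs, (Set.Nonempty.subset_singleton_iff ⟨d, hd⟩).1 fun d hd =>
      hgB.eq_two_of_mem (hdeg.ge hd) (hA1 d hd)⟩

theorem not_topologicallyEquivalent {A B : Set ℕ∞} {f g : ℂ → ℂ} (hA : A.Nonempty)
    (hA' : A ⊆ evenOrInfinite) (hB : B.Nonempty) (hB' : B ⊆ evenOrInfinite) (hAB : A ≠ B)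
    (hf : Realizes A f) (hg : Realizes B g) : ¬ TopologicallyEquivalent f g := by
  rintro ⟨φ, ψ, h⟩
  rcases hf.map_zero hA hA' hg h with ⟨-, h1⟩ | ⟨h0, h1⟩
  · exact hAB h1
  · rcases hg.map_zero hB hB' hf (topologicallyEquivalent_symm h) with ⟨-, h2⟩ | ⟨-, h2⟩
    · exact hAB h2.symm
    · exact hAB (h1.trans h2.symm)

/-! ### The uncountable family -/

open Classical in
/-- A sequence whose set of positive values is the set of successors of the elements of `S`. -/
noncomputable def indexSeq (S : Set ℕ) (i : ℕ) : ℕ := if i ∈ S then i + 1 else 0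

theorem chainDegrees_nonempty (k : ℕ → ℕ) : (chainDegrees k).Nonempty := Set.range_nonempty _

theorem chainDegrees_subset (k : ℕ → ℕ) : chainDegrees k ⊆ evenOrInfinite := by
  rintro _ ⟨i, rfl⟩
  exact .inr ⟨k i + 1, by omega, rfl⟩

/-- Indices outside `S` contribute only the degree 2, so `S` is read off from the degrees that are
at least 4. -/
theorem mem_iff_of_indexSeq {S : Set ℕ} {i : ℕ} :
    i ∈ S ↔ ((2 * (i + 1 + 1) : ℕ) : ℕ∞) ∈ chainDegrees (indexSeq S) := by
  constructor
  · intro h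
    exact ⟨i, by simp only [indexSeq, if_pos h]⟩
  · rintro ⟨j, hj⟩
    rw [Nat.cast_inj] at hj
    by_cases h : j ∈ S
    · simp only [indexSeq, if_pos h] at hj
      have : j = i := by omega
      exact this ▸ h
    · simp only [indexSeq, if_neg h] at hj
      omega

theorem chainDegrees_indexSeq_injective : Function.Injective fun S => chainDegrees (indexSeq S) :=
  fun S S' h => Set.ext fun i => by
    rw [mem_iff_of_indexSeq, mem_iff_of_indexSeq]
    exact (congrArg (_ ∈ ·) h).to_iff

theorem chainFun_indexSeq_injective : Function.Injective fun S => chainFun (indexSeq S) :=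
  fun S S' h => chainDegrees_indexSeq_injective (by
    have h' : chainFun (indexSeq S) = chainFun (indexSeq S') := h
    simp only
    rw [← (realizes_chainFun (indexSeq S)).degrees_eq, h',
      (realizes_chainFun (indexSeq S')).degrees_eq])

theorem mainTheorem10 :
    (∀ A : Set ℕ∞, A.Nonempty → A ⊆ evenOrInfinite →
      ∃ f : ℂ → ℂ, TranscendentalEntire f ∧ Realizes A f) ∧
    (∀ A B : Set ℕ∞, A.Nonempty → A ⊆ evenOrInfinite → B.Nonempty → B ⊆ evenOrInfinite → A ≠ B →
      ∀ f g : ℂ → ℂ, Realizes A f → Realizes B g → ¬ TopologicallyEquivalent f g) ∧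
    (∃ 𝓕 : Set (ℂ → ℂ), ¬ 𝓕.Countable ∧
      (∀ f ∈ 𝓕, TranscendentalEntire f ∧ criticalValues f = {0, 1} ∧ asymptoticValues f = ∅ ∧
        ∃ A : Set ℕ∞, A.Nonempty ∧ A ⊆ evenOrInfinite ∧ Realizes A f) ∧
      (∀ f ∈ 𝓕, ∀ g ∈ 𝓕, f ≠ g → ¬ TopologicallyEquivalent f g)) := by
  refine ⟨fun A hA hA' => exists_realizes hA hA', fun A B hA hA' hB hB' hAB f g hf hg =>
    not_topologicallyEquivalent hA hA' hB hB' hAB hf hg,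
    Set.range fun S => chainFun (indexSeq S), fun hc => ?_, ?_, ?_⟩
  · rw [← Set.image_univ] at hc
    have h1 := Set.countable_univ_iff.1
      (Set.countable_of_injective_of_countable_image chainFun_indexSeq_injective.injOn hc)
    -- Countability of the family would make the power set of ℕ countable, against Cantor's theorem.
    obtain ⟨g, hg⟩ := exists_injective_nat (Set ℕ)
    exact Function.cantor_injective g hg
  · rintro _ ⟨S, rfl⟩
    exact ⟨transcendental_chainFun _, criticalValues_chainFun _, asymptoticValues_chainFun _,
      _, chainDegrees_nonempty _, chainDegrees_subset _, realizes_chainFun _⟩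
  · rintro _ ⟨S, rfl⟩ _ ⟨S', rfl⟩ hne
    refine not_topologicallyEquivalent (chainDegrees_nonempty _) (chainDegrees_subset _)
      (chainDegrees_nonempty _) (chainDegrees_subset _) (fun h => hne ?_)
      (realizes_chainFun _) (realizes_chainFun _)
    rw [chainDegrees_indexSeq_injective h]
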